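/- Let $L$ be an algebraically closed field of characteristic $0$. Put $K_0=L$, $K_{i+1}=K_i((t_{i+1}))^{alg}$ and $K_\omega=\bigcup_i K_i$. For each $n$ let $\pi_{i+1}:P^n(K_{i+1})\to P^n(K_i)$ be the map which rescales homogeneous coordinates so that all of them have non-negative valuation and at least one has valuation $0$ (for the unique extension to $K_{i+1}$ of the order valuation of $K_i((t_{i+1}))$) and then takes residues; let $\Pi_\omega:P^n(K_\omega)\to P^n(L)$ be the map which on $P^n(K_N)$ is $\pi_1\circ\cdots\circ\pi_N$. For a point $a$ with coordinates in $L$ write $\mathcal V_a=\Pi_\omega^{-1}(a)$, where affine space is regarded as a subset of projective space. For a closed set $F\subset A^m\times A^k$ defined over $L$, regarded as a cover of $A^m$, and a point $(a,b)\in F(L)$, the Zariski multiplicity of $F\to A^m$ at $(a,b)$ is $n$ if $\mathcal V_a$ contains points $a'$ of $A^m(K_\omega)$ that are generic over $L$ (no non-zero polynomial over $L$ vanishes at $a'$) and for every such $a'$ the set $F(a',K_\omega)\cap\mathcal V_b$ has exactly $n$ elements. **Theorem.** Let $p_1,p_2\in L[x,y]$ be polynomials with $p_1(0,0)=p_2(0,0)=0$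 which have no common factor vanishing at $(0,0)$ (for example, two non-associated irreducible polynomials vanishing at $(0,0)$). Then the intersection multiplicity $$I(p_1,p_2,(0,0))=\mathrm{length}\bigl(L[x,y]_{(0,0)}/\langle p_1,p_2\rangle\bigr)$$ is finite and equals the Zariski multiplicity at $(0,0,0,0)$ of the cover $$\mathrm{Spec}\bigl(L[x,y,u,v]/\langle p_1-u,\;p_2-v\rangle\bigr)\to \mathrm{Spec}\,L[u,v].$$ -/

import Mathlib

open MvPolynomial
open scoped LinearAlgebra.Projectivization

universe u

noncomputable section

namespace ZariskiStructure

/-! ### The universal extension `K_ω` of `L` -/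

/-- The tower `K₀ = L`, `K_{i+1} = K_i((t_{i+1}))^alg`, each field bundled with its structure. -/
def towerAux (L : Type u) [Field L] : ℕ → (K : Type u) × Field K
  | 0 => ⟨L, inferInstance⟩
  | i + 1 =>
    letI : Field (towerAux L i).1 := (towerAux L i).2
    ⟨AlgebraicClosure (LaurentSeries (towerAux L i).1), inferInstance⟩

/-- The field `K_i`. -/
def Tower (L : Type u) [Field L] (i : ℕ) : Type u := (towerAux L i).1

instance Tower.instField (L : Type u) [Field L] (i : ℕ) : Field (Tower L i) := (towerAux L i).2

/-- `K_{i+1}` is an extension of `K_i((t_{i+1}))`, namely its algebraic closure. -/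
instance Tower.instAlgebraLaurent (L : Type u) [Field L] (i : ℕ) :
    Algebra (LaurentSeries (Tower L i)) (Tower L (i + 1)) :=
  inferInstanceAs
    (Algebra (LaurentSeries (Tower L i)) (AlgebraicClosure (LaurentSeries (Tower L i))))

instance Tower.instIsAlgClosure (L : Type u) [Field L] (i : ℕ) :
    IsAlgClosure (LaurentSeries (Tower L i)) (Tower L (i + 1)) :=
  inferInstanceAs
    (IsAlgClosure (LaurentSeries (Tower L i)) (AlgebraicClosure (LaurentSeries (Tower L i))))

/-- The inclusion `K_i ⊆ K_{i+1}`: constant series. -/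
def Tower.step (L : Type u) [Field L] (i : ℕ) : Tower L i →+* Tower L (i + 1) :=
  (algebraMap (LaurentSeries (Tower L i)) (Tower L (i + 1))).comp HahnSeries.C

/-- The inclusion `K_i ⊆ K_j` for `i ≤ j`, the composite of the one-step inclusions. -/
def Tower.incl (L : Type u) [Field L] (i j : ℕ) (h : i ≤ j) : Tower L i →+* Tower L j :=
  Nat.leRecOn h (fun {k} g => (Tower.step L k).comp g) (RingHom.id (Tower L i))

theorem Tower.incl_self (L : Type u) [Field L] (i : ℕ) :
    Tower.incl L i i le_rfl = RingHom.id (Tower L i) :=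
  Nat.leRecOn_self _

theorem Tower.incl_succ (L : Type u) [Field L] (i j : ℕ) (h : i ≤ j) :
    Tower.incl L i (j + 1) (h.trans (Nat.le_succ j)) =
      (Tower.step L j).comp (Tower.incl L i j h) :=
  Nat.leRecOn_succ h _

instance Tower.instDirectedSystem (L : Type u) [Field L] :
    DirectedSystem (Tower L) (fun i j h => ⇑(Tower.incl L i j h)) where
  map_self i x := by
    rw [Tower.incl_self]
    rfl
  map_map {k j i} hij hjk x := by
    induction k, hjk using Nat.le_induction with
    | base =>
      rw [Tower.incl_self]
      rfl
    | succ k hjk ih =>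
      rw [Tower.incl_succ L j k hjk, Tower.incl_succ L i k (hij.trans hjk)]
      exact congrArg (Tower.step L k) ih

/-- The field `K_ω`, the union of the tower `L = K₀ ⊆ K₁ ⊆ K₂ ⊆ ⋯`. -/
def Kω (L : Type u) [Field L] : Type u := DirectLimit (Tower L) (Tower.incl L)

instance Kω.instField (L : Type u) [Field L] : Field (Kω L) :=
  inferInstanceAs (Field (DirectLimit (Tower L) (Tower.incl L)))

/-- The inclusion `K_i ⊆ K_ω`. -/
def Kω.of (L : Type u) [Field L] (i : ℕ) : Tower L i →+* Kω L :=
  DirectLimit.Ring.of (Tower L) (Tower.incl L) i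

/-- `K_ω` is an extension of `L = K₀`. -/
instance Kω.instAlgebra (L : Type u) [Field L] : Algebra L (Kω L) :=
  RingHom.toAlgebra (Kω.of L 0 : Tower L 0 →+* Kω L)

/-! ### The specialisation map -/

/-- The spectral valuation on `K_{i+1}`, the unique extension of the order valuation of
`F = K_i((t_{i+1}))`: `v(α) = (1/n) ord (N_{F(α)/F} α)` where `n = [F(α) : F]`; `v(0) = ⊤`. -/
def Tower.val (L : Type u) [Field L] (i : ℕ) (α : Tower L (i + 1)) : WithTop ℚ :=
  (Algebra.norm (LaurentSeries (Tower L i))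
    (IntermediateField.AdjoinSimple.gen (LaurentSeries (Tower L i)) α)).orderTop.map
    (fun k : ℤ => (k : ℚ) /
      Module.finrank (LaurentSeries (Tower L i))
        (IntermediateField.adjoin (LaurentSeries (Tower L i)) {α}))

/-- The graph of `π_{i+1} : Pⁿ(K_{i+1}) → Pⁿ(K_i)`: one rescales the homogeneous coordinates of `p`
so that they all have valuation `≥ 0`, not all of them `> 0`, and takes residues in `K_i`.
(`g j` is the residue of `f j` exactly when `v (f j - g j) > 0`, and `g ≠ 0` says that the
scaling is normalised.) -/
def SpecStep (L : Type u) [Field L] (i n : ℕ)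
    (p : ℙ (Tower L (i + 1)) (Fin (n + 1) → Tower L (i + 1)))
    (q : ℙ (Tower L i) (Fin (n + 1) → Tower L i)) : Prop :=
  ∃ (f : Fin (n + 1) → Tower L (i + 1)) (hf : f ≠ 0) (g : Fin (n + 1) → Tower L i) (hg : g ≠ 0),
    Projectivization.mk _ f hf = p ∧ Projectivization.mk _ g hg = q ∧
      ∀ j, 0 < Tower.val L i (f j - Tower.step L i (g j))

/-- The graph of the composite `π₁ ∘ ⋯ ∘ π_N : Pⁿ(K_N) → Pⁿ(K₀) = Pⁿ(L)`. -/
def SpecTower (L : Type u) [Field L] (n : ℕ) :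
    (N : ℕ) → ℙ (Tower L N) (Fin (n + 1) → Tower L N) →
      ℙ (Tower L 0) (Fin (n + 1) → Tower L 0) → Prop
  | 0, p, q => p = q
  | N + 1, p, q => ∃ r, SpecStep L N n p r ∧ SpecTower L n N r q

/-- The graph of the specialisation map `Π_ω : Pⁿ(K_ω) → Pⁿ(L)`, the union over `N` of the maps
`Pⁿ(K_N) → Pⁿ(L)`. -/
def Specialises (L : Type u) [Field L] (n : ℕ)
    (p : ℙ (Kω L) (Fin (n + 1) → Kω L)) (q : ℙ L (Fin (n + 1) → L)) : Prop :=
  ∃ (N : ℕ) (f : Fin (n + 1) → Tower L N) (hf : f ≠ 0) (hg : (fun j => Kω.of L N (f j)) ≠ 0),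
    Projectivization.mk (Kω L) (fun j => Kω.of L N (f j)) hg = p ∧
      SpecTower L n N (Projectivization.mk (Tower L N) f hf) q

/-! ### Infinitesimal neighbourhoods, generic points and Zariski multiplicity -/

/-- The affine point `(x₁, …, x_n)` as the point `(1 : x₁ : ⋯ : x_n)` of `Pⁿ(K)`. -/
def affinePoint {K : Type u} [Field K] {n : ℕ} (x : Fin n → K) : ℙ K (Fin (n + 1) → K) :=
  Projectivization.mk K (Fin.cons 1 x : Fin (n + 1) → K)
    (fun h => one_ne_zero (α := K) (congrFun h 0))

/-- The (affine part of the) infinitesimal neighbourhood `𝒱_a = Π_ω⁻¹(a)` of an affine point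
`a ∈ Aⁿ(L)`. Every point of `Pⁿ(K_ω)` which specialises to `a` lies in the affine chart. -/
def infNhd {L : Type u} [Field L] {n : ℕ} (a : Fin n → L) : Set (Fin n → Kω L) :=
  {x | Specialises L n (affinePoint x) (affinePoint a)}

/-- `x ∈ Aⁿ(K_ω)` is generic in affine space over `L`: it lies on no proper closed subset
defined over `L`. -/
def IsGenericOver (L : Type u) [Field L] {n : ℕ} (x : Fin n → Kω L) : Prop :=
  ∀ f : MvPolynomial (Fin n) L, aeval x f = 0 → f = 0

/-- The fibre `F(x, K_ω)` over `x ∈ A^m(K_ω)` of the closed set `F ⊆ A^m × A^k` cut out by the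
ideal `I`; the variables indexed by `Sum.inl` are the coordinates of the base `A^m`. -/
def fibre {L : Type u} [Field L] {m k : ℕ} (I : Ideal (MvPolynomial (Fin m ⊕ Fin k) L))
    (x : Fin m → Kω L) : Set (Fin k → Kω L) :=
  {y | ∀ f ∈ I, aeval (Sum.elim x y) f = 0}

/-- `n` is the Zariski multiplicity at `(a, b)` of the cover `F → A^m`, where `F ⊆ A^m × A^k` is
the closed set cut out by `I`: there are points `a' ∈ 𝒱_a` which are generic in the base over `L`,
and for each of them `Card (F(a', K_ω) ∩ 𝒱_b) = n`. -/
def HasZariskiMultiplicity {L : Type u} [Field L] {m k : ℕ}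
    (I : Ideal (MvPolynomial (Fin m ⊕ Fin k) L)) (a : Fin m → L) (b : Fin k → L) (n : ℕ) : Prop :=
  (∃ a' ∈ infNhd a, IsGenericOver L a') ∧
    ∀ a' ∈ infNhd a, IsGenericOver L a' → (fibre I a' ∩ infNhd b).encard = n

/-- The ideal `⟨p₁ - u, p₂ - v⟩` of `L[u, v, x, y]`, which defines the cover
`Spec (L[x,y,u,v]/⟨p₁ - u, p₂ - v⟩) → Spec L[u,v]`. Here `u, v` are the variables `inl 0, inl 1`
and `x, y` are the variables `inr 0, inr 1`. -/
def coverIdeal {L : Type u} [Field L] (p₁ p₂ : MvPolynomial (Fin 2) L) :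
    Ideal (MvPolynomial (Fin 2 ⊕ Fin 2) L) :=
  Ideal.span {rename Sum.inr p₁ - X (Sum.inl 0), rename Sum.inr p₂ - X (Sum.inl 1)}

/-! ### Intersection multiplicity -/

/-- The maximal ideal of the origin in `L[x, y]`. -/
abbrev originIdeal (L : Type u) [Field L] : Ideal (MvPolynomial (Fin 2) L) :=
  RingHom.ker (eval (0 : Fin 2 → L))

instance originIdeal.instIsPrime (L : Type u) [Field L] : (originIdeal L).IsPrime :=
  RingHom.ker_isPrime _

/-- The intersection multiplicity `I(p₁, p₂, (0,0))`, the length of `R/⟨p₁, p₂⟩` over the local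
ring `R = L[x,y]_{(0,0)}`. -/
def intersectionMultiplicity {L : Type u} [Field L] (p₁ p₂ : MvPolynomial (Fin 2) L) : ℕ∞ :=
  Module.length (Localization.AtPrime (originIdeal L))
    (Localization.AtPrime (originIdeal L) ⧸
      Ideal.span {algebraMap (MvPolynomial (Fin 2) L) (Localization.AtPrime (originIdeal L)) p₁,
        algebraMap (MvPolynomial (Fin 2) L) (Localization.AtPrime (originIdeal L)) p₂})

end ZariskiStructure

end

/-!
The field `K_ω` carries a place `Π_ω : K_ω → L ∪ {∞}`. Its valuation ring `O` consists of the
elements with a residue in `L`, its maximal ideal of the infinitesimals, and it contains a copy of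
`L`. A point of affine space lies in `𝒱_0` exactly when its coordinates are infinitesimal
(`mem_infNhd_zero`), so only `O`, its residue map `ρ : O → L` and the algebraic closedness of `K_ω`
matter. Let `Z` be the set of infinitesimal points of the fibre `p₁ = a₁, p₂ = a₂` over a generic
infinitesimal point `a`. The proof exhibits `dim_L L[x,y]_(0,0) / ⟨p₁, p₂⟩` polynomials whose
restrictions to `Z` form a basis of the functions `Z → K_ω`.

Let `e₁, …, e_n ∈ L[x,y]` represent a basis of the local ring `L[x,y]_(0,0) / ⟨p₁, p₂⟩` over `L`
(`exists_basis_localRing`). This ring has finite length because a prime below the maximal ideal of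
the origin that contains `p₁` and `p₂` would make the height of the latter exceed `2`; since the
residue field is `L`, length and dimension agree.

*The `e_i` are independent on `Z`* (`linearCombination_injective`). Scale a relation so that
its coefficients lie in `O` and one of them is `1`. The combination `f ∈ O[x,y]` vanishes on `Z`.
Since `a` is generic and the characteristic is zero, the fibre over `a` is finite and its points are
simple, so that the Nullstellensatz gives `s f ∈ ⟨p₁ - a₁, p₂ - a₂⟩` over `K_ω`, with a factor `s`
over `O` that is a unit at the origin (`exists_mul_mem_span_of_vanishing`). Clearing denominators
yields `t s f ∈ ⟨p₁ - a₁, p₂ - a₂⟩` over `O` with `t ≠ 0`. Flatness of the fibres over `O` removes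
`t`: as `p₁, p₂` have no common factor through the origin, the relations between them are
trivial there; this lifts from the special fibre to a relation modulo `t`, by working over a
Noetherian subring of `O` and Krull's intersection theorem (`exists_koszul_lift`,
`exists_mul_map_mem_span`). Reducing modulo the maximal ideal, the residues of the coefficients give
a nontrivial relation between the `e_i` in the local ring, a contradiction.

*The `e_i` span the functions on `Z`* (`linearCombination_surjective`). The restrictions to `Z` of
polynomials over `O` form a finitely generated `O`-module, in which every polynomial that does
not vanish at the origin of the special fibre is invertible. So the `e_i` generate this module
modulo the maximal ideal of `O`, hence generate it, by Nakayama's lemma. By interpolation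
it spans all functions on `Z`.
-/

/-! ### The absolute value on an algebraic extension of a Laurent series field -/

section LaurentNorm

open Valued LaurentSeries MonoidWithZeroHom

/-- The order valuation on Laurent series as a valuation of rank one: `X` has norm `1 / 2`. -/
@[reducible]
noncomputable def laurentRankOne (k : Type u) [Field k] :
    Valuation.RankOne (Valued.v : Valuation k⸨X⸩ (WithZero (Multiplicative ℤ))) where
  hom' := (WithZeroMulInt.toNNReal (e := 2) (by norm_num)).comp
    ValueGroup₀.embedding
  strictMono' := (WithZeroMulInt.toNNReal_strictMono (by norm_num)).comp
    ValueGroup₀.embedding_strictMono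
  exists_val_nontrivial := by
    refine ⟨HahnSeries.single 1 1, ?_, ?_⟩
    · simp
    · rw [LaurentSeries.valuation_single_zpow]
      decide

lemma laurent_valuation_lt_one_iff {k : Type u} [Field k] (f : k⸨X⸩) :
    (Valued.v f : WithZero (Multiplicative ℤ)) < 1 ↔ 0 < f.orderTop := by
  have h1 : (Valued.v f : WithZero (Multiplicative ℤ)) < 1 ↔
      Valued.v f ≤ WithZero.exp (-1 : ℤ) := by
    rcases eq_or_ne (Valued.v f : WithZero (Multiplicative ℤ)) 0 with h | h
    · simp [h]
    · rw [← WithZero.log_le_iff_le_exp h, ← WithZero.exp_zero, ← WithZero.log_lt_iff_lt_exp h]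
      omega
  rw [h1, LaurentSeries.valuation_le_iff_coeff_lt_eq_zero]
  constructor
  · intro h
    refine lt_of_lt_of_le (b := ((1 : ℤ) : WithTop ℤ)) (by norm_cast) ?_
    rw [HahnSeries.le_orderTop_iff_forall]
    intro j hj
    exact h j (by exact_mod_cast hj)
  · intro h n hn
    apply HahnSeries.coeff_eq_zero_of_lt_orderTop
    exact lt_of_le_of_lt (by exact_mod_cast (by omega : n ≤ 0)) h

lemma laurent_valuation_le_one_iff {k : Type u} [Field k] (f : k⸨X⸩) :
    (Valued.v f : WithZero (Multiplicative ℤ)) ≤ 1 ↔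
      f ∈ (HahnSeries.ofPowerSeries ℤ k).range := by
  rw [LaurentSeries.val_le_one_iff_eq_coe]
  rfl

/-- The absolute value on an algebraic extension `E` of `k⸨X⸩` which extends the order valuation.
It is the spectral norm. The last clause says that the residue field of `E` is `k` when `k` is
algebraically closed. -/
theorem exists_absoluteValue_laurent (k : Type u) [Field k] (E : Type u) [Field E]
    [Algebra k⸨X⸩ E] [Algebra.IsAlgebraic k⸨X⸩ E] :
    ∃ v : AbsoluteValue E ℝ, IsNonarchimedean v ∧
      (∀ α : E, v α < 1 ↔
        0 < (Algebra.norm k⸨X⸩ (IntermediateField.AdjoinSimple.gen k⸨X⸩ α)).orderTop) ∧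
      (∀ f : k⸨X⸩, v (algebraMap k⸨X⸩ E f) < 1 ↔ 0 < f.orderTop) ∧
      (∀ c : k, c ≠ 0 → v (algebraMap k⸨X⸩ E (HahnSeries.C c)) = 1) ∧
      (IsAlgClosed k → ∀ α : E, v α ≤ 1 →
        ∃ c : k, v (α - algebraMap k⸨X⸩ E (HahnSeries.C c)) < 1) := by
  let := laurentRankOne k
  let : NontriviallyNormedField k⸨X⸩ :=
    Valued.toNontriviallyNormedField k⸨X⸩ (WithZero (Multiplicative ℤ))
  have : IsUltrametricDist k⸨X⸩ := inferInstance
  have : CompleteSpace k⸨X⸩ := LaurentSeries.instLaurentSeriesComplete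
  have hcoef (α : E) : spectralNorm k⸨X⸩ E α < 1 ↔ 0 < ((minpoly k⸨X⸩ α).coeff 0).orderTop := by
    rw [spectralNorm.spectralNorm_eq_norm_coeff_zero_rpow, ← laurent_valuation_lt_one_iff,
      ← Valued.toNormedField.norm_lt_one_iff,
      Real.rpow_lt_one_iff' (norm_nonneg _)]
    have := minpoly.natDegree_pos (Algebra.IsAlgebraic.isAlgebraic (R := k⸨X⸩) α).isIntegral
    positivity
  refine ⟨MulRingNorm.mulRingNormEquivAbsoluteValue
    (spectralMulAlgNorm k⸨X⸩ E).toMulRingNorm, ?_, ?_, ?_, ?_, ?_⟩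
  · exact isNonarchimedean_spectralNorm
  · intro α
    refine (hcoef α).trans ?_
    have hα : IsIntegral k⸨X⸩ α := (Algebra.IsAlgebraic.isAlgebraic α).isIntegral
    have h := Algebra.PowerBasis.norm_gen_eq_coeff_zero_minpoly
      (IntermediateField.adjoin.powerBasis hα)
    rw [IntermediateField.adjoin.powerBasis_gen, IntermediateField.minpoly_gen] at h
    rw [h]
    rcases neg_one_pow_eq_or k⸨X⸩ (IntermediateField.adjoin.powerBasis hα).dim with h | h <;>
      rw [h] <;> simp
  · intro f
    change spectralNorm k⸨X⸩ E _ < 1 ↔ _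
    rw [spectralNorm_extends, Valued.toNormedField.norm_lt_one_iff, laurent_valuation_lt_one_iff]
  · intro c hc
    change spectralNorm k⸨X⸩ E _ = 1
    rw [spectralNorm_extends]
    have key (d : k) (hd : d ≠ 0) : 1 ≤ ‖(HahnSeries.C d : k⸨X⸩)‖ := by
      rw [← not_lt, Valued.toNormedField.norm_lt_one_iff, laurent_valuation_lt_one_iff]
      simp [HahnSeries.C_apply, HahnSeries.orderTop_single hd]
    refine le_antisymm ?_ (key c hc)
    have := key c⁻¹ (inv_ne_zero hc)
    rw [map_inv₀, norm_inv] at this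
    exact (one_le_inv_iff₀.mp this).2
  · intro hk α hα
    change spectralNorm k⸨X⸩ E α ≤ 1 at hα
    have hint : IsIntegral k⸨X⸩ α := (Algebra.IsAlgebraic.isAlgebraic α).isIntegral
    rw [spectralNorm, spectralValue_le_one_iff (minpoly.monic hint)] at hα
    have hlift : minpoly k⸨X⸩ α ∈ Polynomial.lifts (HahnSeries.ofPowerSeries ℤ k) := by
      rw [Polynomial.lifts_iff_coeff_lifts]
      intro n
      have := hα n
      rw [Valued.toNormedField.norm_le_one_iff, laurent_valuation_le_one_iff] at this
      exact this
    obtain ⟨g, hg, hdeg, hmon⟩ := Polynomial.lifts_and_degree_eq_and_monic hlift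
      (minpoly.monic hint)
    have hpos : 0 < (g.map PowerSeries.constantCoeff).degree := by
      rw [hmon.degree_map, hdeg]
      exact minpoly.degree_pos hint
    obtain ⟨c, hc⟩ := IsAlgClosed.exists_root _ hpos.ne'
    refine ⟨c, ?_⟩
    change spectralNorm k⸨X⸩ E _ < 1
    rw [hcoef, minpoly.sub_algebraMap, Polynomial.coeff_zero_eq_eval_zero, Polynomial.eval_comp,
      ← hg]
    have h1 : Polynomial.eval (HahnSeries.C c) (g.map (HahnSeries.ofPowerSeries ℤ k)) =
        HahnSeries.ofPowerSeries ℤ k (Polynomial.eval (PowerSeries.C c) g) := by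
      rw [Polynomial.eval_map, ← HahnSeries.ofPowerSeries_C, Polynomial.eval₂_at_apply]
    have h2 : PowerSeries.coeff 0 (Polynomial.eval (PowerSeries.C c) g) = 0 := by
      rw [PowerSeries.coeff_zero_eq_constantCoeff, ← Polynomial.eval₂_at_apply]
      simpa [Polynomial.eval_map] using hc
    simp only [Polynomial.eval_add, Polynomial.eval_X, Polynomial.eval_C, zero_add]
    rw [h1]
    refine lt_of_lt_of_le (b := ((1 : ℤ) : WithTop ℤ)) (by norm_cast) ?_
    rw [HahnSeries.le_orderTop_iff_forall]
    intro j hj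
    have hj : j < 1 := by exact_mod_cast hj
    refine (PowerSeries.coeff_coe _ j).trans ?_
    split_ifs with h
    · rfl
    · obtain rfl : j = 0 := by omega
      exact h2

end LaurentNorm

/-! ### Infinitesimal elements of the tower -/

namespace ZariskiStructure

section TowerPlace

theorem Tower.exists_absoluteValue (L : Type u) [Field L] (i : ℕ) :
    ∃ v : AbsoluteValue (Tower L (i + 1)) ℝ, IsNonarchimedean v ∧
      (∀ α, 0 < Tower.val L i α ↔ v α < 1) ∧
      (∀ f, v (algebraMap (LaurentSeries (Tower L i)) (Tower L (i + 1)) f) < 1 ↔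
        0 < f.orderTop) ∧
      (∀ c, c ≠ 0 → v (Tower.step L i c) = 1) ∧
      (IsAlgClosed (Tower L i) → ∀ α, v α ≤ 1 → ∃ c, v (α - Tower.step L i c) < 1) := by
  have halg : Algebra.IsAlgebraic (LaurentSeries (Tower L i)) (Tower L (i + 1)) :=
    (Tower.instIsAlgClosure L i).isAlgebraic
  obtain ⟨v, h1, h2, h3, h4, h5⟩ := exists_absoluteValue_laurent (Tower L i) (Tower L (i + 1))
  refine ⟨v, h1, fun α ↦ ?_, h3, h4, h5⟩
  rw [h2, Tower.val]
  have hα : IsIntegral (LaurentSeries (Tower L i)) α := (halg.isAlgebraic α).isIntegral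
  have := IntermediateField.adjoin.finiteDimensional hα
  have hpos : (0 : ℚ) < Module.finrank (LaurentSeries (Tower L i))
      (IntermediateField.adjoin (LaurentSeries (Tower L i)) {α}) := by
    exact_mod_cast Module.finrank_pos
  generalize (Algebra.norm (LaurentSeries (Tower L i))
    (IntermediateField.AdjoinSimple.gen (LaurentSeries (Tower L i)) α)).orderTop = w
  cases w with
  | top => simp
  | coe k =>
    rw [WithTop.map_coe, ← WithTop.coe_zero, WithTop.coe_lt_coe, ← WithTop.coe_zero,
      WithTop.coe_lt_coe, div_pos_iff_of_pos_right hpos, Int.cast_pos]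

/-- The absolute value on `K_{i+1}` attached to the valuation `Tower.val`. -/
noncomputable def Tower.abs (L : Type u) [Field L] (i : ℕ) : AbsoluteValue (Tower L (i + 1)) ℝ :=
  (Tower.exists_absoluteValue L i).choose

variable {L : Type u} [Field L]

theorem Tower.abs_nonarch (i : ℕ) : IsNonarchimedean (Tower.abs L i) :=
  (Tower.exists_absoluteValue L i).choose_spec.1

theorem Tower.val_pos_iff (i : ℕ) (α : Tower L (i + 1)) :
    0 < Tower.val L i α ↔ Tower.abs L i α < 1 :=
  (Tower.exists_absoluteValue L i).choose_spec.2.1 α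

theorem Tower.abs_algebraMap_lt_iff (i : ℕ) (f : LaurentSeries (Tower L i)) :
    Tower.abs L i (algebraMap (LaurentSeries (Tower L i)) (Tower L (i + 1)) f) < 1 ↔
      0 < f.orderTop :=
  (Tower.exists_absoluteValue L i).choose_spec.2.2.1 f

theorem Tower.abs_step (i : ℕ) {c : Tower L i} (hc : c ≠ 0) :
    Tower.abs L i (Tower.step L i c) = 1 :=
  (Tower.exists_absoluteValue L i).choose_spec.2.2.2.1 c hc

theorem Tower.exists_residue (i : ℕ) [IsAlgClosed (Tower L i)] {α : Tower L (i + 1)}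
    (h : Tower.abs L i α ≤ 1) : ∃ c, Tower.abs L i (α - Tower.step L i c) < 1 :=
  (Tower.exists_absoluteValue L i).choose_spec.2.2.2.2 inferInstance α h

theorem Tower.abs_step_le (i : ℕ) (c : Tower L i) : Tower.abs L i (Tower.step L i c) ≤ 1 := by
  rcases eq_or_ne c 0 with rfl | hc
  · simp
  · exact (Tower.abs_step i hc).le

theorem Tower.abs_add_lt {i : ℕ} {x y : Tower L (i + 1)} (hx : Tower.abs L i x < 1)
    (hy : Tower.abs L i y < 1) : Tower.abs L i (x + y) < 1 :=
  (Tower.abs_nonarch i x y).trans_lt (max_lt hx hy)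

theorem Tower.eq_of_abs_sub_lt {i : ℕ} {x y : Tower L i}
    (h : Tower.abs L i (Tower.step L i x - Tower.step L i y) < 1) : x = y := by
  by_contra hne
  rw [← map_sub, Tower.abs_step i (sub_ne_zero.mpr hne)] at h
  exact lt_irrefl _ h

theorem Tower.abs_le_one_of_sub_lt {i : ℕ} {x : Tower L (i + 1)} {y : Tower L i}
    (h : Tower.abs L i (x - Tower.step L i y) < 1) : Tower.abs L i x ≤ 1 := by
  have := Tower.abs_nonarch i (x - Tower.step L i y) (Tower.step L i y)
  rw [sub_add_cancel] at this
  exact this.trans (max_le h.le (Tower.abs_step_le i y))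

theorem Tower.abs_eq_one_of_sub_lt {i : ℕ} {x : Tower L (i + 1)} {y : Tower L i} (hy : y ≠ 0)
    (h : Tower.abs L i (x - Tower.step L i y) < 1) : Tower.abs L i x = 1 := by
  refine le_antisymm (Tower.abs_le_one_of_sub_lt h) ?_
  by_contra! hlt
  have := Tower.abs_add_lt (x := x) (y := Tower.step L i y - x) hlt
    (by rwa [AbsoluteValue.map_sub])
  rw [add_sub_cancel, Tower.abs_step i hy] at this
  exact lt_irrefl _ this

/-- If `x` and `x'` have residues `y` and `y'`, then `x * x'` has residue `y * y'`. -/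
theorem Tower.abs_mul_sub_lt {i : ℕ} {x x' : Tower L (i + 1)} {y y' : Tower L i}
    (h : Tower.abs L i (x - Tower.step L i y) < 1)
    (h' : Tower.abs L i (x' - Tower.step L i y') < 1) :
    Tower.abs L i (x * x' - Tower.step L i (y * y')) < 1 := by
  have e : x * x' - Tower.step L i (y * y') =
      (x - Tower.step L i y) * x' + Tower.step L i y * (x' - Tower.step L i y') := by
    rw [map_mul]; ring
  rw [e]
  apply Tower.abs_add_lt
  · rw [map_mul]
    exact mul_lt_one_of_nonneg_of_lt_one_left (AbsoluteValue.nonneg _ _) h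
      (Tower.abs_le_one_of_sub_lt h')
  · rw [map_mul]
    exact mul_lt_one_of_nonneg_of_lt_one_right (Tower.abs_step_le i y)
      (AbsoluteValue.nonneg _ _) h'

/-- If `x` has residue `y ≠ 0`, then `x⁻¹` has residue `y⁻¹`. -/
theorem Tower.abs_inv_sub_lt {i : ℕ} {x : Tower L (i + 1)} {y : Tower L i} (hy : y ≠ 0)
    (h : Tower.abs L i (x - Tower.step L i y) < 1) :
    Tower.abs L i (x⁻¹ - Tower.step L i y⁻¹) < 1 := by
  have hx := Tower.abs_eq_one_of_sub_lt hy h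
  have hx0 : x ≠ 0 := by
    rintro rfl
    simp at hx
  have hy0 : Tower.step L i y ≠ 0 := (map_ne_zero _).mpr hy
  have e : x⁻¹ - Tower.step L i y⁻¹ =
      x⁻¹ * (Tower.step L i y)⁻¹ * (-(x - Tower.step L i y)) := by
    rw [map_inv₀]; field_simp; ring
  rw [e, map_mul, map_mul, map_inv₀, map_inv₀, hx, Tower.abs_step i hy, AbsoluteValue.map_neg]
  simpa using h

theorem Tower.isAlgClosed [IsAlgClosed L] : ∀ i, IsAlgClosed (Tower L i)
  | 0 => inferInstanceAs (IsAlgClosed L)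
  | i + 1 => (Tower.instIsAlgClosure L i).isAlgClosed

/-- The infinitesimal elements of `K_N`: those which the place `π₁ ∘ ⋯ ∘ π_N` sends to `0`. -/
def Tower.infinitesimals (L : Type u) [Field L] : (N : ℕ) → Set (Tower L N)
  | 0 => {0}
  | N + 1 => {x | ∃ y ∈ Tower.infinitesimals L N, Tower.abs L N (x - Tower.step L N y) < 1}

namespace Tower

theorem zero_mem_infinitesimals : ∀ N, (0 : Tower L N) ∈ infinitesimals L N
  | 0 => rfl
  | N + 1 => ⟨0, zero_mem_infinitesimals N, by simp⟩

theorem step_mem_infinitesimals {N : ℕ} {x : Tower L N} (hx : x ∈ infinitesimals L N) :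
    step L N x ∈ infinitesimals L (N + 1) :=
  ⟨x, hx, by simp⟩

theorem incl_mem_infinitesimals {M N : ℕ} (h : M ≤ N) {x : Tower L M}
    (hx : x ∈ infinitesimals L M) : incl L M N h x ∈ infinitesimals L N := by
  induction N, h using Nat.le_induction with
  | base => rwa [incl_self]
  | succ N h ih =>
    rw [incl_succ L M N h]
    exact step_mem_infinitesimals ih

theorem add_mem_infinitesimals : ∀ (N : ℕ) {x y : Tower L N}, x ∈ infinitesimals L N →
    y ∈ infinitesimals L N → x + y ∈ infinitesimals L N
  | 0, x, y, hx, hy => by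
    rw [infinitesimals, Set.mem_singleton_iff] at *
    rw [hx, hy, add_zero]
  | N + 1, x, y, ⟨a, ha, ha'⟩, ⟨b, hb, hb'⟩ => by
    refine ⟨a + b, add_mem_infinitesimals N ha hb, ?_⟩
    rw [map_add, add_sub_add_comm]
    exact abs_add_lt ha' hb'

theorem neg_mem_infinitesimals : ∀ (N : ℕ) {x : Tower L N}, x ∈ infinitesimals L N →
    -x ∈ infinitesimals L N
  | 0, x, hx => by
    rw [infinitesimals, Set.mem_singleton_iff] at *
    rw [hx, neg_zero]
  | N + 1, x, ⟨a, ha, ha'⟩ => by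
    refine ⟨-a, neg_mem_infinitesimals N ha, ?_⟩
    rwa [map_neg, ← neg_sub', AbsoluteValue.map_neg]

theorem mul_mem_infinitesimals : ∀ (N : ℕ) {x y : Tower L N}, x ∈ infinitesimals L N →
    y ∈ infinitesimals L N → x * y ∈ infinitesimals L N
  | 0, x, y, hx, hy => by
    rw [infinitesimals, Set.mem_singleton_iff] at *
    rw [hx, zero_mul]
  | N + 1, x, y, ⟨a, ha, ha'⟩, ⟨b, hb, hb'⟩ =>
    ⟨a * b, mul_mem_infinitesimals N ha hb, abs_mul_sub_lt ha' hb'⟩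

theorem one_notMem_infinitesimals : ∀ N, (1 : Tower L N) ∉ infinitesimals L N
  | 0 => by
    rw [infinitesimals, Set.mem_singleton_iff]
    exact one_ne_zero
  | N + 1 => by
    rintro ⟨a, ha, ha'⟩
    rw [← map_one (step L N)] at ha'
    exact one_notMem_infinitesimals N (eq_of_abs_sub_lt ha' ▸ ha)

theorem const_mul_mem_infinitesimals (c : Tower L 0) : ∀ (N : ℕ) {x : Tower L N},
    x ∈ infinitesimals L N → incl L 0 N (Nat.zero_le N) c * x ∈ infinitesimals L N
  | 0, x, hx => by
    rw [infinitesimals, Set.mem_singleton_iff] at *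
    rw [hx, mul_zero]
  | N + 1, x, ⟨a, ha, ha'⟩ => by
    refine ⟨_, const_mul_mem_infinitesimals c N ha, ?_⟩
    rw [incl_succ L 0 N (Nat.zero_le N)]
    exact abs_mul_sub_lt (by simp) ha'

/-- The trichotomy which makes the infinitesimals the maximal ideal of a valuation ring with
residue field `L`. -/
theorem infinitesimals_cases [IsAlgClosed L] : ∀ (N : ℕ) (x : Tower L N),
    x ∈ infinitesimals L N ∨ x⁻¹ ∈ infinitesimals L N ∨
      ∃ c : Tower L 0, x - incl L 0 N (Nat.zero_le N) c ∈ infinitesimals L N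
  | 0, x => by
    refine Or.inr (Or.inr ⟨x, ?_⟩)
    rw [incl_self, infinitesimals, Set.mem_singleton_iff]
    exact sub_self x
  | N + 1, x => by
    have := Tower.isAlgClosed (L := L) N
    rcases le_or_gt (abs L N x) 1 with hx | hx
    · obtain ⟨y, hy⟩ := exists_residue N hx
      rcases infinitesimals_cases N y with h | h | ⟨c, hc⟩
      · exact Or.inl ⟨y, h, hy⟩
      · rcases eq_or_ne y 0 with rfl | hy0
        · exact Or.inl ⟨0, zero_mem_infinitesimals N, hy⟩
        · exact Or.inr (Or.inl ⟨y⁻¹, h, abs_inv_sub_lt hy0 hy⟩)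
      · refine Or.inr (Or.inr ⟨c, _, hc, ?_⟩)
        rw [incl_succ L 0 N (Nat.zero_le N), (step L N).map_sub]
        simpa using hy
    · refine Or.inr (Or.inl ⟨0, zero_mem_infinitesimals N, ?_⟩)
      rw [map_zero, sub_zero, map_inv₀]
      exact inv_lt_one_of_one_lt₀ hx

end Tower

end TowerPlace

section UnionOfTower

variable {L : Type u} [Field L]

theorem Kω.of_incl {M N : ℕ} (h : M ≤ N) (x : Tower L M) :
    Kω.of L N (Tower.incl L M N h x) = Kω.of L M x :=
  DirectLimit.Ring.of_f h x

theorem Kω.exists_of (x : Kω L) : ∃ N y, Kω.of L N y = x := by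
  obtain ⟨N, y, h⟩ := DirectLimit.exists_eq_mk (F := Tower L) (f := Tower.incl L) x
  exact ⟨N, y, h.symm⟩

/-- Finitely many elements of `K_ω` lie in one `K_N`, with any property that the inclusions of the
tower preserve. -/
theorem Kω.exists_common {ι : Type*} [Finite ι] (P : ∀ N, Set (Tower L N))
    (hP : ∀ {M N : ℕ} (h : M ≤ N) {x : Tower L M}, x ∈ P M → Tower.incl L M N h x ∈ P N)
    (x : ι → Kω L) (hx : ∀ j, ∃ N, ∃ y ∈ P N, Kω.of L N y = x j) :
    ∃ (N : ℕ) (y : ι → Tower L N), ∀ j, y j ∈ P N ∧ Kω.of L N (y j) = x j := by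
  choose M y hy hyx using hx
  obtain ⟨N, hN⟩ := (Set.finite_range M).bddAbove
  have hMN (j : ι) : M j ≤ N := hN ⟨j, rfl⟩
  exact ⟨N, fun j ↦ Tower.incl L (M j) N (hMN j) (y j), fun j ↦
    ⟨hP _ (hy j), by rw [Kω.of_incl, hyx]⟩⟩

instance Kω.isAlgClosed [IsAlgClosed L] : IsAlgClosed (Kω L) := by
  refine IsAlgClosed.of_exists_root _ fun p hp hirr ↦ ?_
  obtain ⟨N, y, hy⟩ := Kω.exists_common (ι := Fin (p.natDegree + 1)) (fun _ ↦ Set.univ)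
    (fun _ _ _ ↦ trivial) (fun j ↦ p.coeff j) fun j ↦ by
      obtain ⟨N, y, h⟩ := Kω.exists_of (p.coeff j)
      exact ⟨N, y, trivial, h⟩
  have hlift : p ∈ Polynomial.lifts (Kω.of L N) := by
    rw [Polynomial.lifts_iff_coeff_lifts]
    intro k
    rcases lt_or_ge k (p.natDegree + 1) with hk | hk
    · exact ⟨y ⟨k, hk⟩, (hy ⟨k, hk⟩).2⟩
    · exact ⟨0, by rw [Polynomial.coeff_eq_zero_of_natDegree_lt hk, map_zero]⟩
  obtain ⟨q, rfl, hdeg, -⟩ := Polynomial.lifts_and_degree_eq_and_monic hlift hp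
  have := Tower.isAlgClosed (L := L) N
  obtain ⟨z, hz⟩ := IsAlgClosed.exists_root q (by
    rw [hdeg]
    exact (Polynomial.degree_pos_of_irreducible hirr).ne')
  exact ⟨Kω.of L N z, by rw [Polynomial.eval_map, Polynomial.eval₂_at_apply, hz.eq_zero, map_zero]⟩

/-- The infinitesimal elements of `K_ω`, that is, the maximal ideal of the place `Π_ω`. -/
def Kω.infinitesimals (L : Type u) [Field L] : Set (Kω L) :=
  {x | ∃ N, ∃ y ∈ Tower.infinitesimals L N, Kω.of L N y = x}

namespace Kω

theorem zero_mem_infinitesimals : (0 : Kω L) ∈ infinitesimals L :=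
  ⟨0, 0, Tower.zero_mem_infinitesimals 0, map_zero _⟩

theorem exists_common_infinitesimals {ι : Type*} [Finite ι] {x : ι → Kω L}
    (hx : ∀ j, x j ∈ infinitesimals L) : ∃ (N : ℕ) (y : ι → Tower L N),
      ∀ j, y j ∈ Tower.infinitesimals L N ∧ of L N (y j) = x j :=
  Kω.exists_common _ Tower.incl_mem_infinitesimals x hx

theorem add_mem_infinitesimals {x y : Kω L} (hx : x ∈ infinitesimals L)
    (hy : y ∈ infinitesimals L) : x + y ∈ infinitesimals L := by
  obtain ⟨N, z, hz⟩ := exists_common_infinitesimals (x := ![x, y]) (by simp [Fin.forall_fin_two, *])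
  refine ⟨N, _, Tower.add_mem_infinitesimals N (hz 0).1 (hz 1).1, ?_⟩
  rw [map_add, (hz 0).2, (hz 1).2]
  rfl

theorem mul_mem_infinitesimals {x y : Kω L} (hx : x ∈ infinitesimals L)
    (hy : y ∈ infinitesimals L) : x * y ∈ infinitesimals L := by
  obtain ⟨N, z, hz⟩ := exists_common_infinitesimals (x := ![x, y]) (by simp [Fin.forall_fin_two, *])
  refine ⟨N, _, Tower.mul_mem_infinitesimals N (hz 0).1 (hz 1).1, ?_⟩
  rw [map_mul, (hz 0).2, (hz 1).2]
  rfl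

theorem neg_mem_infinitesimals {x : Kω L} (hx : x ∈ infinitesimals L) :
    -x ∈ infinitesimals L := by
  obtain ⟨N, y, hy, rfl⟩ := hx
  exact ⟨N, _, Tower.neg_mem_infinitesimals N hy, map_neg _ _⟩

theorem const_mul_mem_infinitesimals (c : L) {x : Kω L} (hx : x ∈ infinitesimals L) :
    algebraMap L (Kω L) c * x ∈ infinitesimals L := by
  obtain ⟨N, y, hy, rfl⟩ := hx
  refine ⟨N, _, Tower.const_mul_mem_infinitesimals c N hy, ?_⟩
  rw [map_mul]
  exact congrArg (· * of L N y) (of_incl (Nat.zero_le N) (show Tower L 0 from c))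

theorem one_notMem_infinitesimals : (1 : Kω L) ∉ infinitesimals L := by
  rintro ⟨N, y, hy, h⟩
  rw [← map_one (of L N)] at h
  exact Tower.one_notMem_infinitesimals N ((of L N).injective h ▸ hy)

theorem infinitesimals_cases [IsAlgClosed L] (x : Kω L) :
    x ∈ infinitesimals L ∨ x⁻¹ ∈ infinitesimals L ∨
      ∃ c : L, x - algebraMap L (Kω L) c ∈ infinitesimals L := by
  obtain ⟨N, y, rfl⟩ := exists_of x
  rcases Tower.infinitesimals_cases N y with h | h | ⟨c, h⟩
  · exact Or.inl ⟨N, y, h, rfl⟩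
  · exact Or.inr (Or.inl ⟨N, _, h, map_inv₀ _ _⟩)
  · refine Or.inr (Or.inr ⟨c, N, _, h, ?_⟩)
    rw [map_sub, of_incl]
    rfl

theorem const_eq_zero_of_mem_infinitesimals {c : L}
    (hc : algebraMap L (Kω L) c ∈ infinitesimals L) : c = 0 := by
  by_contra h
  have := const_mul_mem_infinitesimals c⁻¹ hc
  rw [← map_mul, inv_mul_cancel₀ h, map_one] at this
  exact one_notMem_infinitesimals this

/-- The finite elements of `K_ω`: those with a residue in `L`. -/
def finiteElements (L : Type u) [Field L] [IsAlgClosed L] : ValuationSubring (Kω L) where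
  carrier := {x | ∃ c : L, x - algebraMap L (Kω L) c ∈ infinitesimals L}
  zero_mem' := ⟨0, by simpa using zero_mem_infinitesimals⟩
  one_mem' := ⟨1, by simpa using zero_mem_infinitesimals⟩
  add_mem' := by
    rintro x y ⟨c, hc⟩ ⟨d, hd⟩
    refine ⟨c + d, ?_⟩
    rw [map_add, add_sub_add_comm]
    exact add_mem_infinitesimals hc hd
  neg_mem' := by
    rintro x ⟨c, hc⟩
    refine ⟨-c, ?_⟩
    rw [map_neg, ← neg_sub']
    exact neg_mem_infinitesimals hc
  mul_mem' := by
    rintro x y ⟨c, hc⟩ ⟨d, hd⟩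
    refine ⟨c * d, ?_⟩
    have e : x * y - algebraMap L (Kω L) (c * d) =
        (x - algebraMap L (Kω L) c) * (y - algebraMap L (Kω L) d) +
          (algebraMap L (Kω L) d * (x - algebraMap L (Kω L) c) +
            algebraMap L (Kω L) c * (y - algebraMap L (Kω L) d)) := by
      rw [map_mul]; ring
    rw [e]
    exact add_mem_infinitesimals (mul_mem_infinitesimals hc hd) (add_mem_infinitesimals
      (const_mul_mem_infinitesimals d hc) (const_mul_mem_infinitesimals c hd))
  mem_or_inv_mem' x := by
    rcases infinitesimals_cases x with h | h | h
    · exact Or.inl ⟨0, by simpa using h⟩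
    · exact Or.inr ⟨0, by simpa using h⟩
    · exact Or.inl h

/-- The place `Π_ω` of `K_ω`: a valuation ring containing `L`, with a retraction onto `L` whose
kernel is the set of infinitesimals. -/
theorem exists_place (L : Type u) [Field L] [IsAlgClosed L] :
    ∃ (O : ValuationSubring (Kω L)) (_ : Algebra L O) (_ : IsScalarTower L O (Kω L))
      (ρ : O →ₐ[L] L), ∀ x : Kω L, x ∈ infinitesimals L ↔ ∃ h : x ∈ O, ρ ⟨x, h⟩ = 0 := by
  have hmem (c : L) : algebraMap L (Kω L) c ∈ finiteElements L :=
    ⟨c, by simpa using zero_mem_infinitesimals⟩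
  let alg : Algebra L (finiteElements L) :=
    ((algebraMap L (Kω L)).codRestrict (finiteElements L).toSubring hmem).toAlgebra
  have htow : IsScalarTower L (finiteElements L) (Kω L) := IsScalarTower.of_algebraMap_eq' rfl
  have huniq {x : Kω L} {c d : L} (hc : x - algebraMap L (Kω L) c ∈ infinitesimals L)
      (hd : x - algebraMap L (Kω L) d ∈ infinitesimals L) : c = d := by
    rw [← sub_eq_zero]
    apply const_eq_zero_of_mem_infinitesimals
    rw [map_sub]
    convert add_mem_infinitesimals hd (neg_mem_infinitesimals hc) using 1
    ring
  let r : finiteElements L → L := fun x ↦ x.2.choose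
  have hr (x : finiteElements L) : (x : Kω L) - algebraMap L (Kω L) (r x) ∈ infinitesimals L :=
    x.2.choose_spec
  let ρ : finiteElements L →ₐ[L] L :=
    { toFun := r
      map_one' := huniq (hr 1) (by simpa using zero_mem_infinitesimals)
      map_zero' := huniq (hr 0) (by simpa using zero_mem_infinitesimals)
      map_add' := fun x y ↦ huniq (hr (x + y)) (by
        convert add_mem_infinitesimals (hr x) (hr y) using 1
        push_cast
        ring)
      map_mul' := fun x y ↦ huniq (hr (x * y)) (by
        convert add_mem_infinitesimals (mul_mem_infinitesimals (hr x) (hr y))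
          (add_mem_infinitesimals (const_mul_mem_infinitesimals (r x) (hr y))
            (const_mul_mem_infinitesimals (r y) (hr x))) using 1
        push_cast
        ring)
      commutes' := fun c ↦ huniq (hr _) (by
        rw [show ((algebraMap L (finiteElements L) c : finiteElements L) : Kω L) =
          algebraMap L (Kω L) c from rfl, Algebra.algebraMap_self_apply, sub_self]
        exact zero_mem_infinitesimals) }
  refine ⟨finiteElements L, alg, htow, ρ, fun x ↦ ⟨fun hx ↦ ?_, fun ⟨h, hx⟩ ↦ ?_⟩⟩
  · have h : x ∈ finiteElements L := ⟨0, by simpa using hx⟩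
    exact ⟨h, huniq (hr ⟨x, h⟩) (by simpa using hx)⟩
  · have := hr ⟨x, h⟩
    rw [show r ⟨x, h⟩ = 0 from hx] at this
    simpa using this

end Kω

end UnionOfTower

section Specialisation

variable {L : Type u} [Field L]

theorem div_eq_div_of_mk_eq_mk {K ι : Type*} [Field K] {f g : ι → K} (hf : f ≠ 0) (hg : g ≠ 0)
    (h : Projectivization.mk K f hf = Projectivization.mk K g hg) (i j : ι) :
    f i / f j = g i / g j := by
  obtain ⟨a, rfl⟩ := (Projectivization.mk_eq_mk_iff K f g hf hg).mp h
  simp [Units.smul_def, mul_div_mul_left]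

theorem ne_zero_of_mk_eq_mk {K ι : Type*} [Field K] {f g : ι → K} (hf : f ≠ 0) (hg : g ≠ 0)
    (h : Projectivization.mk K f hf = Projectivization.mk K g hg) {i : ι} (hi : g i ≠ 0) :
    f i ≠ 0 := by
  obtain ⟨a, rfl⟩ := (Projectivization.mk_eq_mk_iff K f g hf hg).mp h
  simpa [Units.smul_def] using hi

/-- If `(f₀ : ⋯ : f_n)` specialises to `(1 : 0 : ⋯ : 0)`, then its affine coordinates are
infinitesimal. -/
theorem SpecTower.div_mem_infinitesimals {n : ℕ} : ∀ (N : ℕ) (f : Fin (n + 1) → Tower L N)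
    (hf : f ≠ 0), SpecTower L n N (Projectivization.mk _ f hf)
      (affinePoint (0 : Fin n → Tower L 0)) →
    f 0 ≠ 0 ∧ ∀ j, f j / f 0 ∈ Tower.infinitesimals L N ∨ j = 0
  | 0, f, hf, h => by
    refine ⟨ne_zero_of_mk_eq_mk hf _ h (by simp), fun j ↦ ?_⟩
    rw [div_eq_div_of_mk_eq_mk hf _ h j 0]
    refine Fin.cases (Or.inr rfl) (fun j ↦ Or.inl ?_) j
    simp [Tower.infinitesimals]
  | N + 1, f, hf, ⟨r, ⟨f', hf', g, hg, hff', hgr, hres⟩, hr⟩ => by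
    subst hgr
    obtain ⟨hg0, hgj⟩ := SpecTower.div_mem_infinitesimals N g hg hr
    simp only [Tower.val_pos_iff] at hres
    have h0 : f' 0 ≠ 0 := by
      intro h
      have := Tower.abs_eq_one_of_sub_lt hg0 (hres 0)
      rw [h, map_zero] at this
      exact zero_ne_one this
    refine ⟨ne_zero_of_mk_eq_mk hf hf' hff'.symm h0, fun j ↦ ?_⟩
    rw [div_eq_div_of_mk_eq_mk hf hf' hff'.symm j 0]
    refine (hgj j).imp_left fun h ↦ ⟨_, h, ?_⟩
    rw [div_eq_mul_inv, div_eq_mul_inv]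
    exact Tower.abs_mul_sub_lt (hres j) (Tower.abs_inv_sub_lt hg0 (hres 0))

theorem specTower_affinePoint {n : ℕ} : ∀ (N : ℕ) (y : Fin n → Tower L N),
    (∀ j, y j ∈ Tower.infinitesimals L N) →
      SpecTower L n N (affinePoint y) (affinePoint (0 : Fin n → Tower L 0))
  | 0, y, hy => by
    obtain rfl : y = 0 := funext fun j ↦ hy j
    rfl
  | N + 1, y, hy => by
    choose z hz hyz using hy
    refine ⟨affinePoint z, ⟨_, _, _, _, rfl, rfl, fun j ↦ ?_⟩, specTower_affinePoint N z hz⟩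
    rw [Tower.val_pos_iff]
    refine Fin.cases (by simp) (fun j ↦ ?_) j
    simpa using hyz j

/-- A point of affine space over `K_ω` specialises to the origin if and only if its coordinates
are infinitesimal. -/
theorem mem_infNhd_zero {n : ℕ} (x : Fin n → Kω L) :
    x ∈ infNhd (0 : Fin n → L) ↔ ∀ j, x j ∈ Kω.infinitesimals L := by
  constructor
  · rintro ⟨N, f, hf, hg, hp, hs⟩ j
    obtain ⟨h0, hj⟩ := SpecTower.div_mem_infinitesimals N f hf hs
    refine ⟨N, _, (hj j.succ).resolve_right (Fin.succ_ne_zero j), ?_⟩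
    have := div_eq_div_of_mk_eq_mk hg _ hp j.succ 0
    rw [map_div₀, this]
    simp
  · intro h
    obtain ⟨N, y, hy⟩ := Kω.exists_common_infinitesimals h
    have e : (fun j ↦ Kω.of L N ((Fin.cons 1 y : Fin (n + 1) → Tower L N) j)) =
        (Fin.cons 1 x : Fin (n + 1) → Kω L) := by
      funext j
      refine Fin.cases (by simp) (fun j ↦ ?_) j
      simpa using (hy j).2
    refine ⟨N, Fin.cons 1 y, fun h ↦ one_ne_zero (congrFun h 0), ?_, ?_,
      specTower_affinePoint N y fun j ↦ (hy j).1⟩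
    · rw [e]
      exact fun h ↦ one_ne_zero (congrFun h 0)
    · rw [affinePoint]
      congr 1

end Specialisation

/-! ### A generic point infinitesimally close to the origin -/

section GenericPoint

variable {L : Type u} [Field L]

/-- If `x` is algebraically independent and `y` is transcendental over a field containing `x`, then
`(y, x)` is algebraically independent. -/
theorem eval₂Hom_cons_injective {R K K' : Type*} [CommRing R] [Field K] [Field K'] {n : ℕ}
    (φ : R →+* K) (x : Fin n → K) (hx : Function.Injective (eval₂Hom φ x)) (ψ : K →+* K') (y : K')
    (hy : Function.Injective (Polynomial.eval₂RingHom ψ y)) :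
    Function.Injective (eval₂Hom (ψ.comp φ) (Fin.cons y (ψ ∘ x) : Fin (n + 1) → K')) := by
  have e : eval₂Hom (ψ.comp φ) (Fin.cons y (ψ ∘ x) : Fin (n + 1) → K') =
      ((Polynomial.eval₂RingHom ψ y).comp (Polynomial.mapRingHom (eval₂Hom φ x))).comp
        (finSuccEquiv R n).toRingEquiv.toRingHom := by
    apply MvPolynomial.ringHom_ext
    · intro r
      simp [finSuccEquiv_apply]
    · intro i
      refine Fin.cases ?_ (fun i ↦ ?_) i <;> simp [finSuccEquiv_apply]
  rw [e]
  exact (hy.comp (Polynomial.map_injective _ hx)).comp (finSuccEquiv R n).injective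

/-- The uniformiser `t_{i+1}` of `K_{i+1}`. -/
noncomputable def Tower.uniformiser (L : Type u) [Field L] (i : ℕ) : Tower L (i + 1) :=
  algebraMap (LaurentSeries (Tower L i)) (Tower L (i + 1)) (HahnSeries.single 1 1)

theorem Tower.uniformiser_mem_infinitesimals (i : ℕ) :
    Tower.uniformiser L i ∈ Tower.infinitesimals L (i + 1) := by
  refine ⟨0, Tower.zero_mem_infinitesimals i, ?_⟩
  rw [map_zero, sub_zero, Tower.uniformiser, Tower.abs_algebraMap_lt_iff,
    HahnSeries.orderTop_single one_ne_zero]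
  norm_cast

theorem Tower.eval₂_uniformiser_injective (i : ℕ) :
    Function.Injective (Polynomial.eval₂RingHom (Tower.step L i) (Tower.uniformiser L i)) := by
  have e : Polynomial.eval₂RingHom (Tower.step L i) (Tower.uniformiser L i) =
      (algebraMap (LaurentSeries (Tower L i)) (Tower L (i + 1))).comp
        (algebraMap (Polynomial (Tower L i)) (LaurentSeries (Tower L i))) := by
    apply Polynomial.ringHom_ext
    · intro a
      simp [Tower.step, Polynomial.algebraMap_hahnSeries_apply]
    · simp [Tower.uniformiser, Polynomial.algebraMap_hahnSeries_apply]
  rw [e]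
  exact (algebraMap (LaurentSeries (Tower L i)) (Tower L (i + 1))).injective.comp
    (FaithfulSMul.algebraMap_injective _ _)

/-- The point `(t₂, t₁)` is infinitesimally close to the origin and generic over `L`. -/
theorem exists_generic_mem_infNhd (L : Type u) [Field L] :
    ∃ a ∈ infNhd (0 : Fin 2 → L), IsGenericOver L a := by
  refine ⟨![Kω.of L 2 (Tower.uniformiser L 1), Kω.of L 1 (Tower.uniformiser L 0)], ?_, ?_⟩
  · rw [mem_infNhd_zero, Fin.forall_fin_two]
    exact ⟨⟨_, _, Tower.uniformiser_mem_infinitesimals 1, rfl⟩,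
      ⟨_, _, Tower.uniformiser_mem_infinitesimals 0, rfl⟩⟩
  · let φ : L →+* Tower L 0 := RingHom.id L
    have h0 : Function.Injective (eval₂Hom φ (Fin.elim0 : Fin 0 → Tower L 0)) := by
      intro p q h
      obtain ⟨p, rfl⟩ := C_surjective (Fin 0) p
      obtain ⟨q, rfl⟩ := C_surjective (Fin 0) q
      rw [coe_eval₂Hom, eval₂_C, eval₂_C] at h
      exact congrArg C h
    have h1 := eval₂Hom_cons_injective _ _ h0 _ _ (Tower.eval₂_uniformiser_injective 0)
    have h2 := eval₂Hom_cons_injective _ _ h1 _ _ (Tower.eval₂_uniformiser_injective 1)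
    have h3 := (Kω.of L 2).injective.comp h2
    have hst (x : Tower L 1) : Kω.of L 2 (Tower.step L 1 x) = Kω.of L 1 x := by
      rw [← Kω.of_incl (show 1 ≤ 2 by norm_num), Tower.incl_succ L 1 1 le_rfl, Tower.incl_self]
      rfl
    have hst' (x : Tower L 0) : Kω.of L 1 (Tower.step L 0 x) = Kω.of L 0 x := by
      rw [← Kω.of_incl (show 0 ≤ 1 by norm_num), Tower.incl_succ L 0 0 le_rfl, Tower.incl_self]
      rfl
    have e : (Kω.of L 2).comp (eval₂Hom ((Tower.step L 1).comp ((Tower.step L 0).comp φ))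
        (Fin.cons (Tower.uniformiser L 1)
          (Tower.step L 1 ∘ Fin.cons (Tower.uniformiser L 0) (Tower.step L 0 ∘ Fin.elim0)))) =
        (aeval (R := L) ![Kω.of L 2 (Tower.uniformiser L 1),
          Kω.of L 1 (Tower.uniformiser L 0)]).toRingHom := by
      apply MvPolynomial.ringHom_ext
      · intro c
        refine (congrArg (Kω.of L 2) (eval₂Hom_C _ _ _)).trans ?_
        refine ((hst _).trans (hst' _)).trans ?_
        exact (algHom_C _ c).symm
      · intro i
        refine (congrArg (Kω.of L 2) (eval₂Hom_X' _ _ _)).trans ?_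
        refine Eq.trans ?_ (aeval_X _ i).symm
        fin_cases i
        · rfl
        · exact hst _
    intro f hf
    refine h3 (a₁ := f) (a₂ := 0) ?_
    refine (RingHom.congr_fun e f).trans (hf.trans ?_)
    rw [Function.comp_apply, map_zero, map_zero]

end GenericPoint

/-! ### Koszul exactness and flatness -/

section Koszul

variable {L : Type u} [Field L] {σ : Type*}

/-- Exactness of the Koszul complex of `p₁, p₂` in the middle, in the local ring at the origin:
every relation between `p₁` and `p₂` is, up to a denominator which does not vanish at the origin,
a multiple of the trivial one. -/
def KoszulExactAtOrigin (p₁ p₂ : MvPolynomial σ L) : Prop :=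
  ∀ α β : MvPolynomial σ L, α * p₁ + β * p₂ = 0 →
    ∃ s γ : MvPolynomial σ L, eval 0 s ≠ 0 ∧ s * α = γ * p₂ ∧ s * β = -γ * p₁

/-- The denominator is the greatest common divisor of `p₁` and `p₂`. -/
theorem koszulExactAtOrigin_of_no_common_factor {p₁ p₂ : MvPolynomial σ L}
    (h₂ : eval 0 p₂ = 0) (hcomp : ∀ d, d ∣ p₁ → d ∣ p₂ → eval 0 d ≠ 0) :
    KoszulExactAtOrigin p₁ p₂ := by
  intro α β h
  let := UniqueFactorizationMonoid.toGCDMonoid (MvPolynomial σ L)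
  have hp₁ : p₁ ≠ 0 := by
    rintro rfl
    exact hcomp p₂ (dvd_zero _) dvd_rfl h₂
  obtain ⟨q₁, q₂, hrel, e₁, e₂⟩ : ∃ q₁ q₂, IsRelPrime q₁ q₂ ∧ p₁ = gcd p₁ p₂ * q₁ ∧
      p₂ = gcd p₁ p₂ * q₂ := by
    obtain ⟨q₁, q₂, h1, h2, hu⟩ := extract_gcd p₁ p₂
    exact ⟨q₁, q₂, (gcd_isUnit_iff_isRelPrime).mp hu, h1, h2⟩
  set d := gcd p₁ p₂ with hd
  have hd0 : d ≠ 0 := by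
    intro h
    rw [h, zero_mul] at e₁
    exact hp₁ e₁
  have hq₁ : q₁ ≠ 0 := by
    rintro rfl
    rw [mul_zero] at e₁
    exact hp₁ e₁
  have h' : α * q₁ + β * q₂ = 0 := by
    apply mul_left_cancel₀ hd0
    rw [mul_zero, ← h]
    linear_combination -α * e₁ - β * e₂
  obtain ⟨δ, rfl⟩ : q₁ ∣ β := hrel.dvd_of_dvd_mul_right ⟨-α, by linear_combination h'⟩
  refine ⟨d, -δ, hcomp d (gcd_dvd_left _ _) (gcd_dvd_right _ _), ?_, ?_⟩
  · apply mul_left_cancel₀ hq₁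
    linear_combination d * h' + q₁ * δ * e₂
  · linear_combination -δ * e₁

end Koszul

section LiftKoszul

variable {L : Type u} [Field L] {σ : Type*} {S : Type*} [CommRing S] [Algebra L S]

theorem sub_algebraMap_mem_ker (ε : S →ₐ[L] L) (c : S) :
    c - algebraMap L S (ε c) ∈ RingHom.ker ε := by
  simp [RingHom.mem_ker]

/-- Coordinates on `𝔫 ^ k / 𝔫 ^ (k + 1)`, where `𝔫` is the kernel of an augmentation `S → L`. -/
theorem exists_coordinates_ker_pow [IsNoetherianRing S] (ε : S →ₐ[L] L) (k : ℕ) :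
    ∃ (r : ℕ) (μ : Fin r → S) (φ : Fin r → S →ₗ[L] L), (∀ i, μ i ∈ RingHom.ker ε ^ k) ∧
      (∀ i, ∀ v ∈ RingHom.ker ε ^ (k + 1), φ i v = 0) ∧
      ∀ v ∈ RingHom.ker ε ^ k, v - ∑ i, φ i v • μ i ∈ RingHom.ker ε ^ (k + 1) := by
  set 𝔫 := RingHom.ker ε
  -- `W` is `𝔫 ^ k / 𝔫 ^ (k + 1)`, finite-dimensional as `𝔫 ^ k` is finitely generated.
  let U : Submodule L S := (𝔫 ^ (k + 1)).restrictScalars L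
  let V : Submodule L S := (𝔫 ^ k).restrictScalars L
  let W : Submodule L (S ⧸ U) := V.map U.mkQ
  have hfg : W.FG := by
    obtain ⟨G, hG⟩ := (isNoetherianRing_iff_ideal_fg S).mp inferInstance (𝔫 ^ k)
    classical
    refine ⟨G.image U.mkQ, le_antisymm ?_ ?_⟩
    · rw [Submodule.span_le]
      intro x hx
      simp only [Finset.coe_image, Set.mem_image, Finset.mem_coe] at hx
      obtain ⟨g, hg, rfl⟩ := hx
      have : g ∈ 𝔫 ^ k := hG ▸ Ideal.subset_span hg
      exact ⟨g, this, rfl⟩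
    · rintro _ ⟨v, hv, rfl⟩
      replace hv : v ∈ Ideal.span (G : Set S) := hG ▸ hv
      induction hv using Submodule.span_induction with
      | mem x hx => exact Submodule.subset_span (by simpa using ⟨x, hx, rfl⟩)
      | zero => simp
      | add x y _ _ hx hy => rw [map_add]; exact add_mem hx hy
      | smul c x hx' hx =>
        have e : U.mkQ (c • x) = ε c • U.mkQ x := by
          rw [← map_smul, ← sub_eq_zero, ← map_sub, Submodule.mkQ_apply,
            Submodule.Quotient.mk_eq_zero]
          change c • x - ε c • x ∈ 𝔫 ^ (k + 1)
          rw [smul_eq_mul, Algebra.smul_def (ε c), ← sub_mul, pow_succ']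
          exact Ideal.mul_mem_mul (sub_algebraMap_mem_ker ε c) (hG ▸ hx')
        rw [e]
        exact Submodule.smul_mem _ _ hx
  have : Module.Finite L W := Module.Finite.iff_fg.mpr hfg
  let b := Module.finBasis L W
  have hb (i) : ∃ μ ∈ 𝔫 ^ k, U.mkQ μ = b i := (b i).2
  choose μ hμ hμb using hb
  have hφ (i) : ∃ φ : (S ⧸ U) →ₗ[L] L, φ ∘ₗ W.subtype = b.coord i :=
    LinearMap.exists_extend (b.coord i)
  choose φ hφ using hφ
  refine ⟨_, μ, fun i ↦ φ i ∘ₗ U.mkQ, hμ, fun i v hv ↦ ?_, fun v hv ↦ ?_⟩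
  · have : U.mkQ v = 0 := by
      rw [Submodule.mkQ_apply, Submodule.Quotient.mk_eq_zero]
      exact hv
    rw [LinearMap.comp_apply, this, map_zero]
  · change _ ∈ U
    rw [← Submodule.Quotient.mk_eq_zero, ← Submodule.mkQ_apply, map_sub, map_sum, sub_eq_zero]
    let w : W := ⟨U.mkQ v, v, hv, rfl⟩
    have h1 := congrArg W.subtype (b.sum_repr w)
    rw [map_sum] at h1
    refine h1.symm.trans (Finset.sum_congr rfl fun i _ ↦ ?_)
    rw [map_smul, map_smul, hμb, LinearMap.comp_apply]
    congr 1
    exact (LinearMap.congr_fun (hφ i) w).symm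

/-- Apply an `L`-linear map to all the coefficients of a polynomial. -/
noncomputable def mapCoeffs (φ : S →ₗ[L] L) (f : MvPolynomial σ S) : MvPolynomial σ L :=
  ∑ m ∈ f.support, monomial m (φ (coeff m f))

@[simp]
theorem coeff_mapCoeffs (φ : S →ₗ[L] L) (f : MvPolynomial σ S) (m : σ →₀ ℕ) :
    coeff m (mapCoeffs φ f) = φ (coeff m f) := by
  classical
  rw [mapCoeffs, coeff_sum]
  simp only [coeff_monomial, Finset.sum_ite_eq']
  split_ifs with h
  · rfl
  · rw [notMem_support_iff.mp h, map_zero]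

/-- `mapCoeffs φ` is semilinear on polynomials with coefficients in `𝔫 ^ k`, if `φ` vanishes on
`𝔫 ^ (k + 1)`. -/
theorem mapCoeffs_mul (ε : S →ₐ[L] L) {k : ℕ} (φ : S →ₗ[L] L)
    (hφ : ∀ v ∈ RingHom.ker ε ^ (k + 1), φ v = 0) {f : MvPolynomial σ S}
    (hf : f ∈ Ideal.map C (RingHom.ker ε ^ k)) (P : MvPolynomial σ S) :
    mapCoeffs φ (f * P) = mapCoeffs φ f * map (ε : S →+* L) P := by
  classical
  ext m
  rw [coeff_mapCoeffs, coeff_mul, coeff_mul, map_sum]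
  refine Finset.sum_congr rfl fun x _ ↦ ?_
  rw [coeff_mapCoeffs, coeff_map]
  have hv := mem_map_C_iff.mp hf x.1
  set v := coeff x.1 f
  set c := coeff x.2 P
  have e : v * c = (ε c) • v + v * (c - algebraMap L S (ε c)) := by
    rw [Algebra.smul_def]; ring
  have h0 : φ (v * (c - algebraMap L S (ε c))) = 0 := by
    apply hφ
    rw [pow_succ]
    exact Ideal.mul_mem_mul hv (sub_algebraMap_mem_ker ε c)
  rw [e, map_add, h0, add_zero, map_smul, smul_eq_mul, mul_comm]
  rfl

variable [IsNoetherianRing S] (ε : S →ₐ[L] L) {P₁ P₂ : MvPolynomial σ S}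

/-- The inductive step in lifting Koszul exactness from the special fibre: a relation with
coefficients in `𝔫 ^ k` is trivial modulo `𝔫 ^ (k + 1)`. -/
theorem exists_koszul_step
    (hK : KoszulExactAtOrigin (map (ε : S →+* L) P₁) (map (ε : S →+* L) P₂)) {k : ℕ}
    {α β : MvPolynomial σ S} (hα : α ∈ Ideal.map C (RingHom.ker ε ^ k))
    (hβ : β ∈ Ideal.map C (RingHom.ker ε ^ k)) (h : α * P₁ + β * P₂ = 0) :
    ∃ (s : MvPolynomial σ L) (γ : MvPolynomial σ S), eval 0 s ≠ 0 ∧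
      map (algebraMap L S) s * α - γ * P₂ ∈ Ideal.map C (RingHom.ker ε ^ (k + 1)) ∧
      map (algebraMap L S) s * β + γ * P₁ ∈ Ideal.map C (RingHom.ker ε ^ (k + 1)) := by
  classical
  obtain ⟨r, μ, φ, hμ, hφ, hsum⟩ := exists_coordinates_ker_pow ε k
  have hrel (i) : mapCoeffs (φ i) α * map (ε : S →+* L) P₁ +
      mapCoeffs (φ i) β * map (ε : S →+* L) P₂ = 0 := by
    rw [← mapCoeffs_mul ε (φ i) (hφ i) hα, ← mapCoeffs_mul ε (φ i) (hφ i) hβ]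
    ext m
    rw [coeff_add, coeff_mapCoeffs, coeff_mapCoeffs, ← map_add, ← coeff_add, h, coeff_zero,
      map_zero, coeff_zero]
  choose s γ hs hsα hsβ using fun i ↦ hK _ _ (hrel i)
  set I := Ideal.map (C (σ := σ)) (RingHom.ker ε ^ (k + 1))
  set ι : MvPolynomial σ L →+* MvPolynomial σ S := map (algebraMap L S)
  have hdec {f : MvPolynomial σ S} (hf : f ∈ Ideal.map C (RingHom.ker ε ^ k)) :
      f - ∑ i, C (μ i) * ι (mapCoeffs (φ i) f) ∈ I := by
    rw [mem_map_C_iff]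
    intro m
    rw [coeff_sub, coeff_sum]
    convert hsum _ (mem_map_C_iff.mp hf m) using 3 with i
    rw [coeff_C_mul, coeff_map, coeff_mapCoeffs, Algebra.smul_def, mul_comm]
  have hlift (i) (P : MvPolynomial σ S) : C (μ i) * (ι (map (ε : S →+* L) P) - P) ∈ I := by
    rw [mem_map_C_iff]
    intro m
    rw [coeff_C_mul, coeff_sub, coeff_map, coeff_map, pow_succ]
    refine Ideal.mul_mem_mul (hμ i) ?_
    rw [← neg_sub]
    exact neg_mem (sub_algebraMap_mem_ker ε _)
  -- Bring the relations for the coordinates `φ i` to the common denominator `∏ j, s j`.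
  let t : Fin r → MvPolynomial σ L := fun i ↦ ∏ j ∈ Finset.univ.erase i, s j
  have ht (i) : ∏ j, s j = t i * s i := (Finset.prod_erase_mul _ _ (Finset.mem_univ i)).symm
  refine ⟨∏ j, s j, ∑ i, C (μ i) * ι (t i * γ i), ?_, ?_, ?_⟩
  · rw [map_prod]
    exact Finset.prod_ne_zero_iff.mpr fun i _ ↦ hs i
  · have e : ι (∏ j, s j) * α - (∑ i, C (μ i) * ι (t i * γ i)) * P₂ =
        ι (∏ j, s j) * (α - ∑ i, C (μ i) * ι (mapCoeffs (φ i) α)) +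
          ∑ i, ι (t i * γ i) * (C (μ i) * (ι (map (ε : S →+* L) P₂) - P₂)) := by
      rw [mul_sub, Finset.sum_mul, Finset.mul_sum, sub_add, ← Finset.sum_sub_distrib]
      congr 1
      refine Finset.sum_congr rfl fun i _ ↦ ?_
      have := congrArg ι (hsα i)
      rw [map_mul, map_mul] at this
      rw [ht i, map_mul, map_mul]
      linear_combination -ι (t i) * C (μ i) * this
    rw [e]
    exact add_mem (Ideal.mul_mem_left _ _ (hdec hα))
      (sum_mem fun i _ ↦ Ideal.mul_mem_left _ _ (hlift i P₂))
  · have e : ι (∏ j, s j) * β + (∑ i, C (μ i) * ι (t i * γ i)) * P₁ =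
        ι (∏ j, s j) * (β - ∑ i, C (μ i) * ι (mapCoeffs (φ i) β)) -
          ∑ i, ι (t i * γ i) * (C (μ i) * (ι (map (ε : S →+* L) P₁) - P₁)) := by
      rw [mul_sub, Finset.sum_mul, Finset.mul_sum, sub_sub, ← Finset.sum_add_distrib,
        sub_eq_add_neg, ← Finset.sum_neg_distrib]
      congr 1
      refine Finset.sum_congr rfl fun i _ ↦ ?_
      have := congrArg ι (hsβ i)
      rw [map_mul, map_mul, map_neg] at this
      rw [ht i, map_mul, map_mul]
      linear_combination ι (t i) * C (μ i) * this
    rw [e]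
    exact sub_mem (Ideal.mul_mem_left _ _ (hdec hβ))
      (sum_mem fun i _ ↦ Ideal.mul_mem_left _ _ (hlift i P₁))

theorem exists_koszul_mod_pow
    (hK : KoszulExactAtOrigin (map (ε : S →+* L) P₁) (map (ε : S →+* L) P₂))
    {α β : MvPolynomial σ S} (h : α * P₁ + β * P₂ = 0) (k : ℕ) :
    ∃ (s : MvPolynomial σ L) (γ : MvPolynomial σ S), eval 0 s ≠ 0 ∧
      map (algebraMap L S) s * α - γ * P₂ ∈ Ideal.map C (RingHom.ker ε ^ k) ∧
      map (algebraMap L S) s * β + γ * P₁ ∈ Ideal.map C (RingHom.ker ε ^ k) := by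
  induction k with
  | zero =>
    refine ⟨1, 0, by simp, ?_, ?_⟩ <;> simp [Ideal.map_top]
  | succ k ih =>
    obtain ⟨s, γ, hs, hα, hβ⟩ := ih
    obtain ⟨s', γ', hs', hα', hβ'⟩ := exists_koszul_step ε hK hα hβ
      (by linear_combination map (algebraMap L S) s * h)
    refine ⟨s' * s, map (algebraMap L S) s' * γ + γ', by
      rw [map_mul]
      exact mul_ne_zero hs' hs, ?_, ?_⟩
    · convert hα' using 1
      rw [map_mul]
      ring
    · convert hβ' using 1
      rw [map_mul]
      ring

/-- Koszul exactness at the origin of the special fibre implies Koszul exactness near the origin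
of the special fibre in the total space. This is the local criterion of flatness for the complete
intersection `P₁ = P₂ = 0` over `S`. -/
theorem exists_koszul_lift [Finite σ]
    (hK : KoszulExactAtOrigin (map (ε : S →+* L) P₁) (map (ε : S →+* L) P₂))
    {α β : MvPolynomial σ S} (h : α * P₁ + β * P₂ = 0) :
    ∃ s γ : MvPolynomial σ S, ε (eval 0 s) ≠ 0 ∧ s * α = γ * P₂ ∧ s * β = -γ * P₁ := by
  let e₀ : MvPolynomial σ S →+* L := (ε : S →+* L).comp (eval 0)
  set 𝔐 : Ideal (MvPolynomial σ S) := RingHom.ker e₀ with h𝔐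
  have hmax : 𝔐.IsMaximal := RingHom.ker_isMaximal_of_surjective e₀ fun c ↦
    ⟨C (algebraMap L S c), by
      rw [RingHom.comp_apply, eval_C]
      exact ε.commutes c⟩
  have hC : Ideal.map C (RingHom.ker ε) ≤ 𝔐 := by
    rw [Ideal.map_le_iff_le_comap]
    intro x hx
    simpa [h𝔐, RingHom.mem_ker, e₀] using hx
  -- The class `w` of `(α, β)` modulo the trivial relation lies in every `𝔐 ^ k • ⊤`, so it is
  -- killed by an element of `1 + 𝔐`, by Krull's intersection theorem.
  let T : Submodule (MvPolynomial σ S) (MvPolynomial σ S × MvPolynomial σ S) :=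
    Submodule.span (MvPolynomial σ S) {(P₂, -P₁)}
  let w : (MvPolynomial σ S × MvPolynomial σ S) ⧸ T := T.mkQ (α, β)
  have hw : w ∈ (⨅ k : ℕ, 𝔐 ^ k • ⊤ :
      Submodule (MvPolynomial σ S) ((MvPolynomial σ S × MvPolynomial σ S) ⧸ T)) := by
    rw [Submodule.mem_iInf]
    intro k
    obtain ⟨s, γ, hs, hα, hβ⟩ := exists_koszul_mod_pow ε hK h k
    set s' : MvPolynomial σ S := map (algebraMap L S) s
    have hs' : s' ∉ 𝔐 := by
      have : e₀ s' = eval 0 s := by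
        have h0 : e₀.comp (map (algebraMap L S)) = eval (0 : σ → L) := by
          apply MvPolynomial.ringHom_ext
          · intro c
            simp [e₀]
          · intro i
            simp [e₀]
        exact RingHom.congr_fun h0 s
      rw [h𝔐, RingHom.mem_ker, this]
      exact hs
    have hk : Ideal.map C (RingHom.ker ε ^ k) ≤ 𝔐 ^ k := by
      rw [Ideal.map_pow]
      exact Ideal.pow_right_mono hC k
    have hsw : s' • w ∈ (𝔐 ^ k • ⊤ :
        Submodule (MvPolynomial σ S) ((MvPolynomial σ S × MvPolynomial σ S) ⧸ T)) := by
      have e : s' • w = (s' * α - γ * P₂) • T.mkQ (1, 0) + (s' * β + γ * P₁) • T.mkQ (0, 1) := by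
        rw [← map_smul, ← map_smul, ← map_smul, ← map_add, ← sub_eq_zero, ← map_sub,
          Submodule.mkQ_apply, Submodule.Quotient.mk_eq_zero, Submodule.mem_span_singleton]
        refine ⟨γ, ?_⟩
        ext1 <;> simp [mul_comm]
      rw [e]
      exact add_mem (Submodule.smul_mem_smul (hk hα) trivial)
        (Submodule.smul_mem_smul (hk hβ) trivial)
    obtain ⟨t, m, hm, htm⟩ : ∃ t : MvPolynomial σ S, ∃ m ∈ 𝔐 ^ k, t * s' + m = 1 := by
      have : Ideal.span {s'} ⊔ 𝔐 ^ k = ⊤ := by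
        apply Ideal.sup_pow_eq_top
        rw [sup_comm]
        exact hmax.out.2 _ (left_lt_sup.mpr fun h ↦ hs' (h (Ideal.mem_span_singleton_self s')))
      obtain ⟨a, ha, m, hm, ham⟩ := Submodule.mem_sup.mp (this ▸ Submodule.mem_top (x := 1))
      obtain ⟨t, rfl⟩ := Ideal.mem_span_singleton'.mp ha
      exact ⟨t, m, hm, ham⟩
    have : w = t • s' • w + m • w := by
      rw [smul_smul, ← add_smul, htm, one_smul]
    rw [this]
    exact add_mem (Submodule.smul_mem _ _ hsw) (Submodule.smul_mem_smul hm trivial)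
  obtain ⟨⟨r, hr⟩, hrw⟩ := (Ideal.mem_iInf_smul_pow_eq_bot_iff 𝔐 w).mp hw
  have hmem : (1 - r) • (α, β) ∈ T := by
    rw [← Submodule.Quotient.mk_eq_zero, ← Submodule.mkQ_apply, map_smul, sub_smul, one_smul,
      sub_eq_zero]
    exact hrw.symm
  obtain ⟨γ, hγ⟩ := Submodule.mem_span_singleton.mp hmem
  refine ⟨1 - r, γ, ?_, ?_, ?_⟩
  · have : e₀ r = 0 := hr
    have h1 : e₀ (1 - r) = 1 := by rw [map_sub, map_one, this, sub_zero]
    exact h1 ▸ one_ne_zero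
  · exact (congrArg Prod.fst hγ).symm
  · refine (congrArg Prod.snd hγ).symm.trans ?_
    simp

end LiftKoszul

section TorsionFree

theorem eval_zero_map {A B σ : Type*} [CommSemiring A] [CommSemiring B] (φ : A →+* B)
    (p : MvPolynomial σ A) : eval 0 (map φ p) = φ (eval 0 p) := by
  rw [eval_map]
  exact (eval₂_comp_left φ (RingHom.id A) 0 p ▸ by simp [Function.comp_def, Pi.zero_def])

variable {L R : Type*} [Field L] [CommRing R] [IsDomain R] [Algebra L R] {σ : Type*} [Finite σ]

/-- The local ring of `P₁ = P₂ = 0` at the origin of the special fibre is torsion free over `R`: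
if a nonzero multiple of `f` lies in `⟨P₁, P₂⟩`, then the reduction of `f` lies in
the reduced ideal locally at the origin. The equation involves finitely many elements of `R`,
which makes it possible to replace `R` by a Noetherian subring. -/
theorem exists_mul_map_mem_span (ρ : R →ₐ[L] L) {P₁ P₂ : MvPolynomial σ R}
    (hK : KoszulExactAtOrigin (map (ρ : R →+* L) P₁) (map (ρ : R →+* L) P₂))
    {t : R} (ht : t ≠ 0) {f α β : MvPolynomial σ R} (h : C t * f = α * P₁ + β * P₂) :
    ∃ s : MvPolynomial σ L, eval 0 s ≠ 0 ∧ s * map (ρ : R →+* L) f ∈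
      Ideal.span {map (ρ : R →+* L) P₁, map (ρ : R →+* L) P₂} := by
  classical
  by_cases htρ : ρ t ≠ 0
  · refine ⟨C (ρ t), by rwa [eval_C], ?_⟩
    rw [Ideal.mem_span_pair]
    refine ⟨map (ρ : R →+* L) α, map (ρ : R →+* L) β, ?_⟩
    rw [← map_mul, ← map_mul, ← map_add, ← h, map_mul, map_C]
    rfl
  rw [not_not] at htρ
  -- Replace `R` by the subalgebra `S` generated by the finitely many coefficients involved.
  obtain ⟨G, htG, hfG, hαG, hβG, hP₁G, hP₂G⟩ : ∃ G : Finset R, t ∈ G ∧ f.coeffs ⊆ G ∧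
      α.coeffs ⊆ G ∧ β.coeffs ⊆ G ∧ P₁.coeffs ⊆ G ∧ P₂.coeffs ⊆ G := by
    refine ⟨{t} ∪ f.coeffs ∪ α.coeffs ∪ β.coeffs ∪ P₁.coeffs ∪ P₂.coeffs, ?_, ?_, ?_, ?_, ?_, ?_⟩
    · simp
    all_goals
      intro x hx
      simp [hx]
  let S := Algebra.adjoin L (G : Set R)
  have hfin : Algebra.FiniteType L S := (Subalgebra.fg_iff_finiteType S).mp ⟨G, rfl⟩
  have hnoeth : IsNoetherianRing S := Algebra.FiniteType.isNoetherianRing L S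
  let ι : S →+* R := S.val
  have hι : Function.Injective ι := Subtype.val_injective
  have hG {x : R} (hx : x ∈ G) : x ∈ S := Algebra.subset_adjoin hx
  have hlift {g : MvPolynomial σ R} (hg : g.coeffs ⊆ G) :
      ∃ g' : MvPolynomial σ S, map ι g' = g := by
    change g ∈ Set.range (map ι)
    rw [mem_range_map_iff_coeffs_subset]
    intro x hx
    exact ⟨⟨x, hG (hg hx)⟩, rfl⟩
  obtain ⟨f, rfl⟩ := hlift hfG
  obtain ⟨α, rfl⟩ := hlift hαG
  obtain ⟨β, rfl⟩ := hlift hβG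
  obtain ⟨P₁, rfl⟩ := hlift hP₁G
  obtain ⟨P₂, rfl⟩ := hlift hP₂G
  obtain ⟨t, rfl⟩ : ∃ t', ι t' = t := ⟨⟨t, hG htG⟩, rfl⟩
  have ht0 : t ≠ 0 := by
    rintro rfl
    exact ht (map_zero ι)
  have h : C t * f = α * P₁ + β * P₂ := by
    apply map_injective ι hι
    simpa using h
  -- Modulo `t` the hypothesis is a relation between `P₁` and `P₂`, to which flatness applies.
  let ρ' : S →ₐ[L] L := ρ.comp S.val
  let I : Ideal S := Ideal.span {t}
  let ε : S ⧸ I →ₐ[L] L := Ideal.Quotient.liftₐ I ρ' (by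
    intro a ha
    obtain ⟨b, rfl⟩ := Ideal.mem_span_singleton'.mp ha
    rw [map_mul, show ρ' t = 0 from htρ, mul_zero])
  let q : S →+* S ⧸ I := Ideal.Quotient.mk I
  have hεq (g : MvPolynomial σ S) : map (ε : S ⧸ I →+* L) (map q g) =
      map (ρ : R →+* L) (map ι g) := by
    rw [map_map, map_map]
    rfl
  rw [← hεq, ← hεq] at hK ⊢
  have hrel : map q α * map q P₁ + map q β * map q P₂ = 0 := by
    rw [← map_mul, ← map_mul, ← map_add, ← h, map_mul, map_C,
      show q t = 0 from Ideal.Quotient.eq_zero_iff_mem.mpr (Ideal.mem_span_singleton_self t),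
      C_0, zero_mul]
  obtain ⟨s, γ, hs, hsα, hsβ⟩ := exists_koszul_lift ε hK hrel
  obtain ⟨s, rfl⟩ := map_surjective q Ideal.Quotient.mk_surjective s
  obtain ⟨γ, rfl⟩ := map_surjective q Ideal.Quotient.mk_surjective γ
  have hdvd {g : MvPolynomial σ S} (hg : map q g = 0) : C t ∣ g :=
    (C_dvd_iff_map_hom_eq_zero q t (fun x ↦ by
      rw [← Ideal.mem_span_singleton, ← Ideal.Quotient.eq_zero_iff_mem]) g).mpr hg
  obtain ⟨α', hα'⟩ := hdvd (g := s * α - γ * P₂) (by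
    rw [map_sub, map_mul, map_mul, hsα, sub_self])
  obtain ⟨β', hβ'⟩ := hdvd (g := s * β + γ * P₁) (by
    rw [map_add, map_mul, map_mul, hsβ, neg_mul, neg_add_cancel])
  have hsf : s * f = α' * P₁ + β' * P₂ := by
    apply mul_left_cancel₀ (C_ne_zero.mpr ht0)
    linear_combination s * h + P₁ * hα' + P₂ * hβ'
  refine ⟨map (ε : S ⧸ I →+* L) (map q s), ?_, ?_⟩
  · rwa [eval_zero_map]
  · rw [hεq s, ← map_mul, ← map_mul, hsf, Ideal.mem_span_pair]
    exact ⟨map (ρ : R →+* L) (map ι α'), map (ρ : R →+* L) (map ι β'), by simp [hεq]⟩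

end TorsionFree

/-! ### Generic fibres are finite and unramified -/

section GenericFibre

variable {L K σ : Type*} [Field L] [Field K] [Algebra L K]

theorem algebraicIndependent_of_aeval_eq {p : σ → MvPolynomial σ L} {a : σ → K}
    (ha : AlgebraicIndependent L a) {w : σ → K} (hw : ∀ i, aeval w (p i) = a i) :
    AlgebraicIndependent L p := by
  rw [algebraicIndependent_iff] at ha ⊢
  intro f hf
  refine ha f ?_
  have : aeval a f = aeval w (aeval p f) := by
    rw [← AlgHom.comp_apply, comp_aeval]
    simp only [hw]
  rw [this, hf, map_zero]

variable [Fintype σ]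

theorem isAlgebraic_adjoin_of_algebraicIndependent {p : σ → MvPolynomial σ L}
    (hp : AlgebraicIndependent L p) :
    Algebra.IsAlgebraic (Algebra.adjoin L (Set.range p)) (MvPolynomial σ L) := by
  refine (hp.isTranscendenceBasis_of_lift_trdeg_le_of_finite ?_).isAlgebraic
  rw [trdeg_of_isDomain]
  simp

/-- Over a generic point `a`, the coordinates of a point of the fibre of `p` are algebraically
independent. -/
theorem aeval_injective_of_generic {p : σ → MvPolynomial σ L} {a : σ → K}
    (ha : AlgebraicIndependent L a) {w : σ → K} (hw : ∀ i, aeval w (p i) = a i) :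
    Function.Injective (aeval w : MvPolynomial σ L →ₐ[L] K) := by
  have hp := algebraicIndependent_of_aeval_eq ha hw
  have halg := isAlgebraic_adjoin_of_algebraicIndependent hp
  rw [injective_iff_map_eq_zero]
  intro g hg
  by_contra hg0
  refine Ideal.comap_ne_bot_of_algebraic_mem (I := RingHom.ker (aeval w : MvPolynomial σ L →ₐ[L] K))
    hg0 hg (halg.isAlgebraic g) ?_
  rw [eq_bot_iff]
  intro b hb
  have hrange (x : MvPolynomial σ L) (hx : x ∈ Algebra.adjoin L (Set.range p)) :
      ∃ f : MvPolynomial σ L, aeval p f = x := by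
    rwa [Algebra.adjoin_range_eq_range_aeval] at hx
  obtain ⟨f, hf⟩ := hrange b b.2
  have hb : aeval w (b : MvPolynomial σ L) = 0 := hb
  rw [← hf, ← AlgHom.comp_apply, comp_aeval] at hb
  simp only [hw] at hb
  rw [Ideal.mem_bot, ← ZeroMemClass.coe_eq_zero, ← hf,
    (algebraicIndependent_iff.mp ha) f hb, map_zero]

/-- The derivative of a polynomial at the point `w` in the direction `ξ`. -/
noncomputable def directionalDerivative (w ξ : σ → K) : MvPolynomial σ L →ₗ[L] K :=
  ∑ j, ξ j • ((aeval w).toLinearMap ∘ₗ (pderiv j).toLinearMap)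

theorem directionalDerivative_apply (w ξ : σ → K) (f : MvPolynomial σ L) :
    directionalDerivative w ξ f = ∑ j, ξ j * aeval w (pderiv j f) := by
  simp [directionalDerivative]

theorem directionalDerivative_X [DecidableEq σ] (w ξ : σ → K) (j : σ) :
    directionalDerivative w ξ (X j : MvPolynomial σ L) = ξ j := by
  rw [directionalDerivative_apply, Finset.sum_eq_single j]
  · simp
  · intro i _ hij
    rw [pderiv_X_of_ne hij.symm]
    simp
  · simp

theorem directionalDerivative_mul (w ξ : σ → K) (f g : MvPolynomial σ L) :
    directionalDerivative w ξ (f * g) =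
      aeval w f * directionalDerivative w ξ g + aeval w g * directionalDerivative w ξ f := by
  simp only [directionalDerivative_apply, Finset.mul_sum, ← Finset.sum_add_distrib]
  refine Finset.sum_congr rfl fun j _ ↦ ?_
  rw [Derivation.leibniz, map_add, smul_eq_mul, smul_eq_mul, map_mul, map_mul]
  ring

theorem directionalDerivative_C (w ξ : σ → K) (c : L) :
    directionalDerivative w ξ (C c : MvPolynomial σ L) = 0 := by
  simp [directionalDerivative_apply]

theorem directionalDerivative_pow (w ξ : σ → K) (f : MvPolynomial σ L) (n : ℕ) :
    directionalDerivative w ξ (f ^ n) =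
      n * aeval w f ^ (n - 1) * directionalDerivative w ξ f := by
  induction n with
  | zero => simpa using directionalDerivative_C w ξ (1 : L)
  | succ n ih =>
    rw [pow_succ, directionalDerivative_mul, ih]
    rcases n with _ | n
    · simp
    · simp only [map_pow, Nat.add_sub_cancel]
      push_cast
      ring

variable {p : σ → MvPolynomial σ L} {w ξ : σ → K}

theorem directionalDerivative_eq_zero_of_mem_adjoin
    (hξ : ∀ i, directionalDerivative w ξ (p i) = 0) {b : MvPolynomial σ L}
    (hb : b ∈ Algebra.adjoin L (Set.range p)) : directionalDerivative w ξ b = 0 := by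
  induction hb using Algebra.adjoin_induction with
  | mem x hx =>
    obtain ⟨i, rfl⟩ := hx
    exact hξ i
  | algebraMap r => exact directionalDerivative_C w ξ r
  | add x y _ _ hx hy => rw [map_add, hx, hy, add_zero]
  | mul x y _ _ hx hy => rw [directionalDerivative_mul, hx, hy, mul_zero, mul_zero, add_zero]

theorem directionalDerivative_aeval (hξ : ∀ i, directionalDerivative w ξ (p i) = 0)
    (g : MvPolynomial σ L) (h : Polynomial (Algebra.adjoin L (Set.range p))) :
    directionalDerivative w ξ (Polynomial.aeval g h) =
      aeval w (Polynomial.aeval g (Polynomial.derivative h)) * directionalDerivative w ξ g := by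
  induction h using Polynomial.induction_on' with
  | add f g hf hg => simp only [map_add, hf, hg, add_mul]
  | monomial n b =>
    rw [Polynomial.aeval_monomial, Polynomial.derivative_monomial, Polynomial.aeval_monomial,
      directionalDerivative_mul, directionalDerivative_pow]
    have : directionalDerivative w ξ
        (algebraMap (Algebra.adjoin L (Set.range p)) (MvPolynomial σ L) b) = 0 :=
      directionalDerivative_eq_zero_of_mem_adjoin hξ b.2
    rw [this, map_mul, map_mul, map_mul, map_natCast, map_natCast, map_pow, map_pow]
    ring

/-- The fibre over a generic point is unramified: in characteristic zero, a tangent vector killed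
by the differentials of the `p i` is zero, because the coordinates are separably algebraic over
the `p i`. -/
theorem eq_zero_of_directionalDerivative_eq_zero [CharZero L] {a : σ → K}
    (ha : AlgebraicIndependent L a) (hw : ∀ i, aeval w (p i) = a i)
    (hξ : ∀ i, directionalDerivative w ξ (p i) = 0) : ξ = 0 := by
  classical
  have hinj := aeval_injective_of_generic ha hw
  have halg := isAlgebraic_adjoin_of_algebraicIndependent (algebraicIndependent_of_aeval_eq ha hw)
  -- If `h(g) = 0` then `h'(g) * dg = 0`; descend to an `h` of least degree, where `h'(g) ≠ 0`.
  have key (g : MvPolynomial σ L) : ∀ (n : ℕ) (h : Polynomial (Algebra.adjoin L (Set.range p))),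
      h.natDegree ≤ n → h ≠ 0 → Polynomial.aeval g h = 0 → directionalDerivative w ξ g = 0 := by
    intro n
    induction n with
    | zero =>
      intro h hn h0 hg
      rw [Polynomial.eq_C_of_natDegree_le_zero hn] at h0 hg
      rw [Polynomial.aeval_C] at hg
      have := (FaithfulSMul.algebraMap_injective
        (Algebra.adjoin L (Set.range p)) (MvPolynomial σ L)) (hg.trans (map_zero _).symm)
      exact absurd (by rw [this, Polynomial.C_0]) h0
    | succ n ih =>
      intro h hn h0 hg
      by_cases hd : h.natDegree = 0
      · exact ih h (by omega) h0 hg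
      by_cases hder : Polynomial.aeval g (Polynomial.derivative h) = 0
      · refine ih _ (by have := Polynomial.natDegree_derivative_lt hd; omega) ?_ hder
        rwa [Ne, Polynomial.derivative_eq_zero]
      · have := directionalDerivative_aeval hξ g h
        rw [hg, map_zero] at this
        refine (mul_eq_zero.mp this.symm).resolve_left ?_
        rwa [map_eq_zero_iff _ hinj]
  funext j
  obtain ⟨h, h0, hg⟩ := halg.isAlgebraic (X j)
  rw [← directionalDerivative_X (L := L) w ξ j]
  exact key _ _ h le_rfl h0 hg

/-- All points of the fibre induce the same embedding of `L[p]` in `K`, so each of their coordinates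
is a root of one fixed polynomial. -/
theorem finite_fibre_of_generic {a : σ → K} (ha : AlgebraicIndependent L a) :
    {w : σ → K | ∀ i, aeval w (p i) = a i}.Finite := by
  classical
  rcases Set.eq_empty_or_nonempty {w : σ → K | ∀ i, aeval w (p i) = a i} with h | ⟨w₀, hw₀⟩
  · rw [h]
    exact Set.finite_empty
  have halg := isAlgebraic_adjoin_of_algebraicIndependent (algebraicIndependent_of_aeval_eq ha hw₀)
  have hinj := aeval_injective_of_generic ha hw₀
  set B := Algebra.adjoin L (Set.range p)
  let ψ : (σ → K) → B →ₐ[L] K := fun w ↦ (aeval w).comp B.val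
  have hψ {w : σ → K} (hw : ∀ i, aeval w (p i) = a i) : ψ w = ψ w₀ := by
    apply AlgHom.adjoin_ext
    rintro _ ⟨i, rfl⟩
    exact (hw i).trans (hw₀ i).symm
  choose h h0 hX using fun j ↦ halg.isAlgebraic (X j : MvPolynomial σ L)
  have hψinj : Function.Injective (ψ w₀ : B →+* K) := hinj.comp Subtype.val_injective
  refine (Set.Finite.pi' fun j ↦
    (((h j).map (ψ w₀ : B →+* K)).roots.toFinset).finite_toSet).subset ?_
  intro w hw j
  rw [Finset.mem_coe, Multiset.mem_toFinset, Polynomial.mem_roots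
    ((Polynomial.map_ne_zero_iff hψinj).mpr (h0 j)), Polynomial.IsRoot.def, ← hψ hw]
  have := congrArg (aeval w) (hX j)
  rw [map_zero, Polynomial.aeval_def] at this
  rw [Polynomial.eval_map, ← this, ← AlgHom.coe_toRingHom (aeval w), Polynomial.hom_eval₂]
  simp
  rfl

end GenericFibre

/-! ### Polynomials vanishing at the infinitesimal points of a generic fibre -/

section SimpleZeros

variable {K : Type*} [Field K]

theorem exists_eq_mul_sub_add_mul_sub (w : Fin 2 → K) (P : MvPolynomial (Fin 2) K)
    (hP : eval w P = 0) : ∃ A B : MvPolynomial (Fin 2) K,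
      P = A * (X 0 - C (w 0)) + B * (X 1 - C (w 1)) := by
  have key : P - C (eval w P) ∈ Ideal.span {X 0 - C (w 0), X 1 - C (w 1)} := by
    clear hP
    induction P using MvPolynomial.induction_on with
    | C c => simp
    | add P Q hP hQ =>
      convert add_mem hP hQ using 1
      simp only [map_add]
      ring
    | mul_X P i hP =>
      have e : P * X i - C (eval w (P * X i)) =
          X i * (P - C (eval w P)) + C (eval w P) * (X i - C (w i)) := by
        simp only [map_mul, eval_X]
        ring
      rw [e]
      refine add_mem (Ideal.mul_mem_left _ _ hP) (Ideal.mul_mem_left _ _ (Ideal.subset_span ?_))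
      fin_cases i <;> simp
  rw [hP, C_0, sub_zero, Ideal.mem_span_pair] at key
  obtain ⟨A, B, h⟩ := key
  exact ⟨A, B, h.symm⟩

/-- At a zero `w` of `P₁` and `P₂` where the Jacobian does not vanish, the local ideal
`⟨P₁, P₂⟩` is the maximal ideal: by Cramer's rule the Jacobian determinant multiplies the
coordinate functions at `w` into it. -/
theorem exists_mul_mem_of_jacobian_ne_zero {P₁ P₂ f : MvPolynomial (Fin 2) K} {w : Fin 2 → K}
    (h₁ : eval w P₁ = 0) (h₂ : eval w P₂ = 0) (hf : eval w f = 0)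
    (hJ : eval w (pderiv 0 P₁) * eval w (pderiv 1 P₂) -
      eval w (pderiv 1 P₁) * eval w (pderiv 0 P₂) ≠ 0) :
    ∃ s : MvPolynomial (Fin 2) K, eval w s ≠ 0 ∧ s * f ∈ Ideal.span {P₁, P₂} := by
  obtain ⟨A₁, B₁, e₁⟩ := exists_eq_mul_sub_add_mul_sub w P₁ h₁
  obtain ⟨A₂, B₂, e₂⟩ := exists_eq_mul_sub_add_mul_sub w P₂ h₂
  obtain ⟨A, B, e⟩ := exists_eq_mul_sub_add_mul_sub w f hf
  have hd {P A B : MvPolynomial (Fin 2) K}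
      (h : P = A * (X 0 - C (w 0)) + B * (X 1 - C (w 1))) :
      eval w (pderiv 0 P) = eval w A ∧ eval w (pderiv 1 P) = eval w B := by
    have h01 : pderiv (0 : Fin 2) (X 1 : MvPolynomial (Fin 2) K) = 0 :=
      pderiv_X_of_ne (by decide)
    have h10 : pderiv (1 : Fin 2) (X 0 : MvPolynomial (Fin 2) K) = 0 :=
      pderiv_X_of_ne (by decide)
    constructor <;> rw [h] <;> simp [Derivation.leibniz, h01, h10]
  rw [(hd e₁).1, (hd e₁).2, (hd e₂).1, (hd e₂).2] at hJ
  refine ⟨A₁ * B₂ - B₁ * A₂, by simpa using hJ, ?_⟩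
  rw [Ideal.mem_span_pair]
  refine ⟨A * B₂ - B * A₂, B * A₁ - A * B₁, ?_⟩
  rw [e, e₁, e₂]
  ring

end SimpleZeros

section VanishingOnInfinitesimalZeros

variable {L K : Type*} [Field L] [Field K] {O : ValuationSubring K} [Algebra L O]

/-- The elements of `K` which a place `ρ`, defined on the valuation ring `O`, sends to `0`. -/
def placeKernel (ρ : O →ₐ[L] L) : Set K :=
  {x | ∃ h : x ∈ O, ρ ⟨x, h⟩ = 0}

/-- A point which does not specialise to the origin is separated from the origin by a polynomial
over `O`. -/
theorem exists_separating (ρ : O →ₐ[L] L) {w : Fin 2 → K} (hw : ¬ ∀ j, w j ∈ placeKernel ρ) :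
    ∃ l : MvPolynomial (Fin 2) O, ρ (eval 0 l) ≠ 0 ∧ eval w (map (algebraMap O K) l) = 0 := by
  rw [not_forall] at hw
  obtain ⟨j, hj⟩ := hw
  by_cases hO : w j ∈ O
  · refine ⟨X j - C ⟨w j, hO⟩, ?_, ?_⟩
    · rw [map_sub, eval_X, eval_C, Pi.zero_apply, zero_sub, map_neg, neg_ne_zero]
      exact fun h ↦ hj ⟨hO, h⟩
    · rw [map_sub, map_X, map_C, map_sub, eval_X, eval_C]
      exact sub_self _
  · have hO' : (w j)⁻¹ ∈ O := (O.mem_or_inv_mem (w j)).resolve_left hO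
    have h0 : w j ≠ 0 := by
      intro h
      exact hO (h ▸ O.zero_mem)
    refine ⟨1 - C ⟨(w j)⁻¹, hO'⟩ * X j, ?_, ?_⟩
    · simp
    · rw [map_sub, map_mul, map_X, map_C, map_one, map_sub, map_mul, eval_X, eval_C, map_one]
      exact sub_eq_zero.mpr (inv_mul_cancel₀ h0).symm

variable [Algebra L K] [IsAlgClosed K] [CharZero L]

/-- A polynomial which vanishes at all the infinitesimal points of a generic fibre lies in the ideal
of the fibre, locally at the origin of the special fibre. -/
theorem exists_mul_mem_span_of_vanishing (ρ : O →ₐ[L] L) (p : Fin 2 → MvPolynomial (Fin 2) L)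
    {a : Fin 2 → K} (ha : AlgebraicIndependent L a) (f : MvPolynomial (Fin 2) K)
    (hf : ∀ w : Fin 2 → K, (∀ i, aeval w (p i) = a i) → (∀ j, w j ∈ placeKernel ρ) →
      eval w f = 0) :
    ∃ s : MvPolynomial (Fin 2) O, ρ (eval 0 s) ≠ 0 ∧ map (algebraMap O K) s * f ∈
      Ideal.span {map (algebraMap L K) (p 0) - C (a 0), map (algebraMap L K) (p 1) - C (a 1)} := by
  classical
  set P : Fin 2 → MvPolynomial (Fin 2) K := fun i ↦ map (algebraMap L K) (p i) - C (a i) with hPdef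
  have hP (w : Fin 2 → K) (i) : eval w (P i) = aeval w (p i) - a i := by
    rw [hPdef, map_sub, eval_C, eval_map, aeval_def]
  have hPd (w : Fin 2 → K) (i j) : eval w (pderiv j (P i)) = aeval w (pderiv j (p i)) := by
    rw [hPdef, map_sub, pderiv_C, sub_zero, pderiv_map, eval_map, aeval_def]
  change ∃ s : MvPolynomial (Fin 2) O, ρ (eval 0 s) ≠ 0 ∧ map (algebraMap O K) s * f ∈
    Ideal.span {P 0, P 1}
  set J := Ideal.span {P 0, P 1}
  -- By the Nullstellensatz it suffices that `s` vanishes at the zeros of `Jf = (J : f)`. They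
  -- are non-infinitesimal points of the fibre, since `f ∈ J` locally at the infinitesimal ones.
  let Jf : Ideal (MvPolynomial (Fin 2) K) :=
    Submodule.comap (LinearMap.toSpanSingleton _ (MvPolynomial (Fin 2) K) f) J
  have hJf (s) : s ∈ Jf ↔ s * f ∈ J := Iff.rfl
  have hzero {w : Fin 2 → K} (hw : w ∈ zeroLocus K Jf) (i) : aeval w (p i) = a i := by
    have hi : P i ∈ Jf := by
      rw [hJf]
      refine Ideal.mul_mem_right _ _ (Ideal.subset_span ?_)
      fin_cases i <;> simp
    have := mem_zeroLocus_iff.mp hw _ hi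
    rw [aeval_eq_eval] at this
    exact sub_eq_zero.mp ((hP w i).symm.trans this)
  have hfin := finite_fibre_of_generic (p := p) ha
  have hsep (w : Fin 2 → K) : ∃ l : MvPolynomial (Fin 2) O, ρ (eval 0 l) ≠ 0 ∧
      ((¬ ∀ j, w j ∈ placeKernel ρ) → eval w (map (algebraMap O K) l) = 0) := by
    by_cases hw : ∀ j, w j ∈ placeKernel ρ
    · exact ⟨1, by simp, fun h ↦ absurd hw h⟩
    · obtain ⟨l, h1, h2⟩ := exists_separating ρ hw
      exact ⟨l, h1, fun _ ↦ h2⟩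
  choose l hl0 hl using hsep
  set s : MvPolynomial (Fin 2) O := ∏ w ∈ hfin.toFinset, l w
  have hs0 : ρ (eval 0 s) ≠ 0 := by
    rw [map_prod, map_prod]
    exact Finset.prod_ne_zero_iff.mpr fun w _ ↦ hl0 w
  have hvan : map (algebraMap O K) s ∈ vanishingIdeal K (zeroLocus K Jf) := by
    rw [mem_vanishingIdeal_iff]
    intro w hw
    have hw' := hzero hw
    rw [aeval_eq_eval]
    by_cases hinf : ∀ j, w j ∈ placeKernel ρ
    · exfalso
      have hJ : eval w (pderiv 0 (P 0)) * eval w (pderiv 1 (P 1)) -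
          eval w (pderiv 1 (P 0)) * eval w (pderiv 0 (P 1)) ≠ 0 := by
        intro hdet
        let M : Matrix (Fin 2) (Fin 2) K := Matrix.of fun i j ↦ aeval w (pderiv j (p i))
        have hM : M.det = 0 := by
          rw [Matrix.det_fin_two, ← hdet]
          simp only [hPd]
          rfl
        obtain ⟨ξ, hξ0, hξ⟩ := Matrix.exists_mulVec_eq_zero_iff.mpr hM
        refine hξ0 (eq_zero_of_directionalDerivative_eq_zero ha hw' fun i ↦ ?_)
        rw [directionalDerivative_apply]
        have := congrFun hξ i
        rw [Matrix.mulVec, dotProduct] at this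
        rw [← Pi.zero_apply (M := fun _ ↦ K) i, ← this]
        exact Finset.sum_congr rfl fun j _ ↦ mul_comm _ _
      obtain ⟨g, hg0, hg⟩ := exists_mul_mem_of_jacobian_ne_zero (P₁ := P 0) (P₂ := P 1)
        (by rw [hP, hw', sub_self]) (by rw [hP, hw', sub_self]) (hf w hw' hinf) hJ
      have := mem_zeroLocus_iff.mp hw g ((hJf g).mpr hg)
      rw [aeval_eq_eval] at this
      exact hg0 this
    · have hmem : w ∈ hfin.toFinset := hfin.mem_toFinset.mpr hw'
      rw [map_prod, map_prod]
      exact Finset.prod_eq_zero hmem (hl w hinf)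
  rw [vanishingIdeal_zeroLocus_eq_radical] at hvan
  obtain ⟨k, hk⟩ := hvan
  refine ⟨s ^ k, ?_, ?_⟩
  · rw [map_pow, map_pow]
    exact pow_ne_zero k hs0
  · rw [map_pow]
    exact hk

end VanishingOnInfinitesimalZeros

/-! ### Counting the infinitesimal points of a generic fibre -/

section Comparison

variable {L K : Type*} [Field L] [Field K] {O : ValuationSubring K} [Algebra L O]

/-- Two polynomials over `K` have a common denominator in `O`. -/
theorem exists_C_mul_eq_map (f : MvPolynomial (Fin 2) K) (g : MvPolynomial (Fin 2) K) :
    ∃ t : O, t ≠ 0 ∧ ∃ f' g' : MvPolynomial (Fin 2) O,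
      C (t : K) * f = map (algebraMap O K) f' ∧ C (t : K) * g = map (algebraMap O K) g' := by
  classical
  obtain ⟨t, ht⟩ := IsLocalization.exist_integer_multiples_of_finset (nonZeroDivisors O)
    (f.coeffs ∪ g.coeffs : Finset K)
  have key (h : MvPolynomial (Fin 2) K) (hh : h.coeffs ⊆ f.coeffs ∪ g.coeffs) :
      ∃ h' : MvPolynomial (Fin 2) O, C ((t : O) : K) * h = map (algebraMap O K) h' := by
    suffices hr : C ((t : O) : K) * h ∈ Set.range (map (algebraMap O K)) by
      obtain ⟨h', e⟩ := hr
      exact ⟨h', e.symm⟩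
    rw [mem_range_map_iff_coeffs_subset]
    intro x hx
    rw [Finset.mem_coe, mem_coeffs_iff] at hx
    obtain ⟨m, -, rfl⟩ := hx
    rw [coeff_C_mul]
    by_cases hm : coeff m h = 0
    · exact ⟨0, by rw [hm, mul_zero, map_zero]⟩
    · obtain ⟨y, hy⟩ := ht _ (hh (coeff_mem_coeffs m hm))
      exact ⟨y, by rw [hy, Algebra.smul_def]; rfl⟩
  obtain ⟨f', hf'⟩ := key f Finset.subset_union_left
  obtain ⟨g', hg'⟩ := key g Finset.subset_union_right
  exact ⟨t, nonZeroDivisors.coe_ne_zero t, f', g', hf', hg'⟩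

theorem map_map_algebraMap (ρ : O →ₐ[L] L) (p : MvPolynomial (Fin 2) L) :
    map (ρ : O →+* L) (map (algebraMap L O) p) = p := by
  rw [map_map, show (ρ : O →+* L).comp (algebraMap L O) = RingHom.id L from
    RingHom.ext fun c ↦ ρ.commutes c, map_id]

variable [Algebra L K] [IsScalarTower L O K]

theorem eval_map_map_algebraMap (w : Fin 2 → K) (p : MvPolynomial (Fin 2) L) :
    eval w (map (algebraMap O K) (map (algebraMap L O) p)) = aeval w p := by
  rw [map_map, ← IsScalarTower.algebraMap_eq, eval_map, aeval_def]

variable [IsAlgClosed K] [CharZero L]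

/-- A polynomial over `O` which vanishes at all the infinitesimal points of a fibre over an
infinitesimal generic point reduces to an element of the ideal of the special fibre, locally at
the origin. -/
theorem exists_mul_map_mem_span_of_vanishing (ρ : O →ₐ[L] L)
    (p : Fin 2 → MvPolynomial (Fin 2) L) (hK : KoszulExactAtOrigin (p 0) (p 1))
    {a : Fin 2 → K} (ha : AlgebraicIndependent L a) (ha0 : ∀ i, a i ∈ placeKernel ρ)
    (f : MvPolynomial (Fin 2) O)
    (hf : ∀ w : Fin 2 → K, (∀ i, aeval w (p i) = a i) → (∀ j, w j ∈ placeKernel ρ) →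
      eval w (map (algebraMap O K) f) = 0) :
    ∃ s : MvPolynomial (Fin 2) L, eval 0 s ≠ 0 ∧
      s * map (ρ : O →+* L) f ∈ Ideal.span {p 0, p 1} := by
  obtain ⟨s, hs, hmem⟩ := exists_mul_mem_span_of_vanishing ρ p ha _ hf
  obtain ⟨α, β, h⟩ := Ideal.mem_span_pair.mp hmem
  obtain ⟨t, ht, α', β', hα', hβ'⟩ := exists_C_mul_eq_map (O := O) α β
  choose aO ha' using ha0
  let P (i : Fin 2) : MvPolynomial (Fin 2) O := map (algebraMap L O) (p i) - C ⟨a i, aO i⟩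
  have hP (i) : map (algebraMap O K) (P i) = map (algebraMap L K) (p i) - C (a i) := by
    rw [map_sub, map_map, ← IsScalarTower.algebraMap_eq, map_C]
    rfl
  have hPρ (i) : map (ρ : O →+* L) (P i) = p i := by
    rw [map_sub, map_map_algebraMap, map_C]
    change p i - C (ρ _) = p i
    rw [ha' i, C_0, sub_zero]
  have hrel : C t * (s * f) = α' * P 0 + β' * P 1 := by
    apply map_injective (algebraMap O K) Subtype.val_injective
    rw [map_add, map_mul _ α', map_mul _ β', hP, hP, ← hα', ← hβ', map_mul, map_mul, ← h, map_C]
    change C (t : K) * _ = _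
    ring
  obtain ⟨s', hs', hmem'⟩ := exists_mul_map_mem_span ρ (by rw [hPρ, hPρ]; exact hK) ht hrel
  rw [hPρ, hPρ, map_mul] at hmem'
  refine ⟨s' * map (ρ : O →+* L) s, ?_, by rwa [mul_assoc]⟩
  rw [map_mul]
  refine mul_ne_zero hs' ?_
  rw [eval_zero_map]
  exact hs

/-- Polynomials which are linearly independent in the local ring of the special fibre at the origin
are linearly independent over `K` as functions on the infinitesimal points `Z` of a generic
fibre. -/
theorem linearCombination_injective (ρ : O →ₐ[L] L)
    (p : Fin 2 → MvPolynomial (Fin 2) L) (hK : KoszulExactAtOrigin (p 0) (p 1))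
    {a : Fin 2 → K} (ha : AlgebraicIndependent L a) (ha0 : ∀ i, a i ∈ placeKernel ρ)
    {Z : Set (Fin 2 → K)}
    (hZ : ∀ w : Fin 2 → K, (∀ i, aeval w (p i) = a i) → (∀ j, w j ∈ placeKernel ρ) → w ∈ Z)
    {ι : Type*} [Fintype ι] (e : ι → MvPolynomial (Fin 2) L)
    (he : ∀ c : ι → L, (∃ s : MvPolynomial (Fin 2) L, eval 0 s ≠ 0 ∧
      s * ∑ i, C (c i) * e i ∈ Ideal.span {p 0, p 1}) → c = 0) :
    Function.Injective
      (Fintype.linearCombination K (fun i (z : Z) ↦ aeval (z : Fin 2 → K) (e i))) := by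
  rw [injective_iff_map_eq_zero]
  intro c hc
  by_contra hc0
  have : Nonempty ι := by
    by_contra hι
    rw [not_nonempty_iff] at hι
    exact hc0 (Subsingleton.elim _ _)
  -- Scale the relation so that its coefficients lie in `O` and one of them is `1`.
  obtain ⟨k, hk⟩ := Finite.exists_max fun i ↦ O.valuation (c i)
  have hck : c k ≠ 0 := by
    intro h
    refine hc0 (funext fun i ↦ ?_)
    have := hk i
    rwa [h, map_zero, le_zero_iff, map_eq_zero] at this
  have hO (i) : c i / c k ∈ O := by
    rw [← O.valuation_le_one_iff, map_div₀]
    exact div_le_one_of_le₀ (hk i) zero_le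
  let d (i : ι) : O := ⟨c i / c k, hO i⟩
  let f : MvPolynomial (Fin 2) O := ∑ i, C (d i) * map (algebraMap L O) (e i)
  obtain ⟨s, hs, hmem⟩ := exists_mul_map_mem_span_of_vanishing ρ p hK ha ha0 f (by
    intro w hw hw0
    have h := congrFun hc ⟨w, hZ w hw hw0⟩
    rw [Fintype.linearCombination_apply, Finset.sum_apply, Pi.zero_apply] at h
    have h' : eval w (map (algebraMap O K) f) = (∑ i, c i * aeval w (e i)) / c k := by
      rw [map_sum, map_sum, Finset.sum_div]
      refine Finset.sum_congr rfl fun i _ ↦ ?_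
      rw [map_mul, map_mul, eval_map_map_algebraMap, map_C, eval_C]
      change c i / c k * _ = _
      ring
    rw [h', div_eq_zero_iff]
    exact Or.inl h)
  have hfρ : map (ρ : O →+* L) f = ∑ i, C (ρ (d i)) * e i := by
    rw [map_sum]
    refine Finset.sum_congr rfl fun i _ ↦ ?_
    rw [map_mul, map_map_algebraMap, map_C]
    rfl
  rw [hfρ] at hmem
  have h1 := congrFun (he _ ⟨s, hs, hmem⟩) k
  have hdk : d k = 1 := Subtype.ext (div_self hck)
  simp only [hdk, map_one, Pi.zero_apply, one_ne_zero] at h1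

end Comparison

section Spanning

variable {L K : Type*} [Field L] [Field K] {O : ValuationSubring K} [Algebra L O]

theorem aeval_prod_X_sub_C_eq_zero {R ι : Type*} [CommRing R] [Fintype ι] (g : ι → R) :
    Polynomial.aeval g (∏ i, (Polynomial.X - Polynomial.C (g i))) = 0 := by
  classical
  funext i
  rw [map_prod, Finset.prod_apply, Pi.zero_apply]
  refine Finset.prod_eq_zero (Finset.mem_univ i) ?_
  simp

theorem isUnit_of_apply_ne_zero (ρ : O →ₐ[L] L) {x : O} (hx : ρ x ≠ 0) : IsUnit x := by
  by_contra h
  have hle : RingHom.ker ρ ≤ IsLocalRing.maximalIdeal O :=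
    IsLocalRing.le_maximalIdeal (RingHom.ker_ne_top _)
  have : x - algebraMap L O (ρ x) ∈ RingHom.ker ρ := by
    rw [RingHom.mem_ker, map_sub, AlgHom.commutes]
    exact sub_self _
  have hu : algebraMap L O (ρ x) ∈ IsLocalRing.maximalIdeal O := by
    have := sub_mem ((IsLocalRing.mem_maximalIdeal x).mpr h) (hle this)
    rwa [sub_sub_cancel] at this
  exact (IsLocalRing.mem_maximalIdeal _).mp hu ((isUnit_iff_ne_zero.mpr hx).map _)

variable {ι : Type*} (ζ : ι → Fin 2 → O)

/-- Evaluation of polynomials over `O` at a finite family of `O`-valued points. -/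
noncomputable def evalPoints : MvPolynomial (Fin 2) O →ₐ[O] (ι → O) :=
  aeval fun j i ↦ ζ i j

theorem evalPoints_apply (f : MvPolynomial (Fin 2) O) (i : ι) :
    evalPoints ζ f i = eval (ζ i) f := by
  have : ((Pi.evalAlgHom O (fun _ : ι ↦ O) i).comp (evalPoints ζ)) = aeval (ζ i) := by
    ext j
    simp [evalPoints]
  rw [← aeval_eq_eval, ← this]
  rfl

theorem evalPoints_mem_smul (ρ : O →ₐ[L] L) {f : MvPolynomial (Fin 2) O}
    (hf : map (ρ : O →+* L) f = 0) :
    evalPoints ζ f ∈ RingHom.ker ρ • LinearMap.range (evalPoints ζ).toLinearMap := by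
  rw [f.as_sum, map_sum]
  refine Submodule.sum_mem _ fun m _ ↦ ?_
  rw [← mul_one (coeff m f), ← smul_eq_mul, ← smul_monomial, map_smul]
  refine Submodule.smul_mem_smul ?_ ⟨_, rfl⟩
  have := congrArg (coeff m) hf
  rwa [coeff_map, coeff_zero] at this

variable [Fintype ι]

theorem fg_range_evalPoints : (LinearMap.range (evalPoints ζ).toLinearMap).FG := by
  have h : Subalgebra.toSubmodule (Algebra.adjoin O (Set.range fun (j : Fin 2) i ↦ ζ i j)) =
      LinearMap.range (evalPoints ζ).toLinearMap := by
    rw [Algebra.adjoin_range_eq_range_aeval]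
    rfl
  rw [← h]
  refine fg_adjoin_of_finite (Set.finite_range _) ?_
  rintro _ ⟨j, rfl⟩
  exact ⟨∏ i, (Polynomial.X - Polynomial.C (ζ i j)),
    Polynomial.monic_prod_of_monic _ _ fun i _ ↦ Polynomial.monic_X_sub_C _,
    aeval_prod_X_sub_C_eq_zero _⟩

/-- A polynomial which does not vanish at the origin of the special fibre is invertible on
infinitesimal points, and its inverse is again given by a polynomial, because its
characteristic polynomial has an invertible constant coefficient. -/
theorem exists_evalPoints_mul_eq_one (ρ : O →ₐ[L] L) (hζ : ∀ i j, ρ (ζ i j) = 0)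
    {s : MvPolynomial (Fin 2) O} (hs : ρ (eval 0 s) ≠ 0) :
    ∃ s', evalPoints ζ (s' * s) = 1 := by
  have hu (i) : IsUnit (evalPoints ζ s i) := by
    refine isUnit_of_apply_ne_zero ρ ?_
    rw [evalPoints_apply]
    convert hs using 1
    change (ρ : O →+* L) (eval (ζ i) s) = (ρ : O →+* L) (eval 0 s)
    rw [eval₂_comp, eval₂_comp]
    congr 1
    funext j
    exact (hζ i j).trans (map_zero (ρ : O →+* L)).symm
  set g := evalPoints ζ s with hg
  let χ : Polynomial O := ∏ i, (Polynomial.X - Polynomial.C (g i))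
  have hχ : Polynomial.aeval g χ = 0 := aeval_prod_X_sub_C_eq_zero g
  have hc : IsUnit (χ.coeff 0) := by
    rw [Polynomial.coeff_zero_eq_eval_zero, Polynomial.eval_prod, IsUnit.prod_iff]
    intro i _
    simpa using hu i
  obtain ⟨c, hc⟩ := hc
  rw [← Polynomial.divX_mul_X_add χ, ← hc] at hχ
  refine ⟨C (-(↑c⁻¹ : O)) * Polynomial.aeval s χ.divX, ?_⟩
  have h1 : evalPoints ζ (Polynomial.aeval s χ.divX) = Polynomial.aeval g χ.divX := by
    rw [hg, Polynomial.aeval_algHom_apply]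
  rw [map_mul, map_mul, h1, ← hg]
  rw [map_add, map_mul, Polynomial.aeval_X, Polynomial.aeval_C] at hχ
  have h2 : evalPoints ζ (C (-(↑c⁻¹ : O))) = algebraMap O (ι → O) (-(↑c⁻¹ : O)) :=
    (evalPoints ζ).commutes _
  rw [h2, mul_assoc, eq_neg_of_add_eq_zero_left hχ, map_neg, neg_mul_neg, ← map_mul,
    Units.inv_mul, map_one]

/-- Polynomials which span the local ring of the special fibre at the origin span the ring of
polynomial functions on infinitesimal points `ζ` of a fibre over an infinitesimal
point, by Nakayama's lemma. -/
theorem range_evalPoints_le_span (ρ : O →ₐ[L] L) (hζ : ∀ i j, ρ (ζ i j) = 0)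
    (p : Fin 2 → MvPolynomial (Fin 2) L) {a : Fin 2 → O} (ha0 : ∀ k, ρ (a k) = 0)
    (hp : ∀ i k, eval (ζ i) (map (algebraMap L O) (p k)) = a k)
    {κ : Type*} [Fintype κ] (e : κ → MvPolynomial (Fin 2) L)
    (he : ∀ f, ∃ c : κ → L, ∃ s : MvPolynomial (Fin 2) L, eval 0 s ≠ 0 ∧
      s * (f - ∑ i, C (c i) * e i) ∈ Ideal.span {p 0, p 1}) :
    LinearMap.range (evalPoints ζ).toLinearMap ≤
      Submodule.span O (Set.range fun i ↦ evalPoints ζ (map (algebraMap L O) (e i))) := by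
  refine Submodule.le_of_le_smul_of_le_jacobson_bot (I := RingHom.ker ρ) (fg_range_evalPoints ζ)
    ?_ ?_
  · rw [IsLocalRing.jacobson_eq_maximalIdeal _ bot_ne_top]
    exact IsLocalRing.le_maximalIdeal (RingHom.ker_ne_top _)
  rintro _ ⟨f, rfl⟩
  obtain ⟨c, s, hs, hmem⟩ := he (map (ρ : O →+* L) f)
  obtain ⟨α, β, hαβ⟩ := Ideal.mem_span_pair.mp hmem
  let lift : MvPolynomial (Fin 2) L →+* MvPolynomial (Fin 2) O := map (algebraMap L O)
  have hlift (q) : map (ρ : O →+* L) (lift q) = q := map_map_algebraMap ρ q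
  obtain ⟨s', hs'⟩ := exists_evalPoints_mul_eq_one ζ ρ hζ (s := lift s) (by
    change (ρ : O →+* L) _ ≠ 0
    rwa [← eval_zero_map, hlift])
  have hpE (k) : evalPoints ζ (lift (p k)) = evalPoints ζ (C (a k)) := by
    funext i
    rw [evalPoints_apply, evalPoints_apply, eval_C]
    exact hp i k
  let g := f - ∑ i, C (algebraMap L O (c i)) * lift (e i)
  have hgρ : map (ρ : O →+* L) g = map (ρ : O →+* L) f - ∑ i, C (c i) * e i := by
    rw [map_sub, map_sum]
    congr 1
    refine Finset.sum_congr rfl fun i _ ↦ ?_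
    rw [map_mul, hlift, map_C]
    exact congrArg (fun x ↦ C x * e i) (ρ.commutes (c i))
  -- `g` agrees with `h` at the points `ζ`, and `h` reduces to zero.
  let h := s' * (lift s * g - (lift α * lift (p 0) + lift β * lift (p 1))) +
    s' * (lift α * C (a 0) + lift β * C (a 1))
  have hE : evalPoints ζ g = evalPoints ζ h := by
    have h1 : evalPoints ζ h = evalPoints ζ (s' * lift s) * evalPoints ζ g := by
      simp only [h, map_add, map_mul, map_sub, hpE]
      ring
    rw [h1, hs', one_mul]
  have hρ : map (ρ : O →+* L) h = 0 := by
    have haρ (k) : map (ρ : O →+* L) (C (a k) : MvPolynomial (Fin 2) O) = 0 := by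
      rw [map_C]
      exact (congrArg C (ha0 k)).trans C_0
    simp only [h, map_add, map_mul, map_sub, hlift, haρ, hgρ, hαβ]
    ring
  rw [Submodule.mem_sup]
  refine ⟨evalPoints ζ (∑ i, C (algebraMap L O (c i)) * lift (e i)), ?_, evalPoints ζ g, ?_, ?_⟩
  · rw [map_sum]
    refine Submodule.sum_mem _ fun i _ ↦ ?_
    rw [← smul_eq_C_mul, map_smul]
    exact Submodule.smul_mem _ _ (Submodule.subset_span ⟨i, rfl⟩)
  · rw [hE]
    exact evalPoints_mem_smul ζ ρ hρ
  · rw [← map_add]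
    exact congrArg (evalPoints ζ) (add_sub_cancel _ f)

end Spanning

section SurjectiveOnPoints

variable {L K : Type*} [Field L] [Field K] {O : ValuationSubring K} [Algebra L O]
  [Algebra L K] [IsScalarTower L O K]

/-- Polynomials which span the local ring of the special fibre at the origin span the functions on
any finite set `Z` of infinitesimal points of a fibre over an infinitesimal point. -/
theorem linearCombination_surjective (ρ : O →ₐ[L] L)
    (p : Fin 2 → MvPolynomial (Fin 2) L) {a : Fin 2 → K} (ha0 : ∀ i, a i ∈ placeKernel ρ)
    {Z : Set (Fin 2 → K)} [Finite Z]
    (hZ : ∀ w ∈ Z, (∀ i, aeval w (p i) = a i) ∧ ∀ j, w j ∈ placeKernel ρ)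
    {κ : Type*} [Fintype κ] (e : κ → MvPolynomial (Fin 2) L)
    (he : ∀ f, ∃ c : κ → L, ∃ s : MvPolynomial (Fin 2) L, eval 0 s ≠ 0 ∧
      s * (f - ∑ i, C (c i) * e i) ∈ Ideal.span {p 0, p 1}) :
    Function.Surjective
      (Fintype.linearCombination K (fun i (z : Z) ↦ aeval (z : Fin 2 → K) (e i))) := by
  classical
  have := Fintype.ofFinite Z
  choose aO ha' using ha0
  have hw (z : Z) := (hZ z z.2).2
  choose wO hw' using hw
  let ζ (z : Z) (j : Fin 2) : O := ⟨z.1 j, wO z j⟩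
  have heval (q : MvPolynomial (Fin 2) O) (z : Z) :
      ((eval (ζ z) q : O) : K) = eval z.1 (map (algebraMap O K) q) := by
    rw [eval_map]
    exact eval₂_comp (algebraMap O K) (ζ z) q
  have hle := range_evalPoints_le_span ζ ρ hw' p (a := fun k ↦ ⟨a k, aO k⟩) ha' (fun z k ↦ by
    apply Subtype.ext
    rw [heval, eval_map_map_algebraMap]
    exact (hZ z z.2).1 k) e he
  set T := Fintype.linearCombination K (fun i (z : Z) ↦ aeval (z : Fin 2 → K) (e i)) with hT
  have hmem (q : MvPolynomial (Fin 2) O) :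
      (fun z : Z ↦ ((eval (ζ z) q : O) : K)) ∈ LinearMap.range T := by
    have h : evalPoints ζ q ∈ Submodule.span O
        (Set.range fun i ↦ evalPoints ζ (map (algebraMap L O) (e i))) := hle ⟨q, rfl⟩
    rw [Submodule.mem_span_range_iff_exists_fun] at h
    obtain ⟨c, hc⟩ := h
    refine ⟨fun i ↦ c i, ?_⟩
    rw [hT, Fintype.linearCombination_apply]
    funext z
    have hz := congrFun hc z
    rw [Finset.sum_apply] at hz ⊢
    rw [← evalPoints_apply, ← hz]
    push_cast
    refine Finset.sum_congr rfl fun i _ ↦ ?_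
    rw [Pi.smul_apply, Pi.smul_apply, evalPoints_apply, smul_eq_mul, smul_eq_mul]
    push_cast
    rw [heval, eval_map_map_algebraMap]
  rw [← LinearMap.range_eq_top, eq_top_iff, ← (Pi.basisFun K Z).span_eq, Submodule.span_le]
  rintro _ ⟨z₀, rfl⟩
  -- Interpolation: some product of functions `X j - C (z j)` vanishes exactly off `z₀`.
  have hne (z : Z) : ∃ j, z ≠ z₀ → ζ z₀ j - ζ z j ≠ 0 := by
    by_cases h : z = z₀
    · exact ⟨0, fun h' ↦ absurd h h'⟩
    · have h' : z.1 ≠ z₀.1 := fun h'' ↦ h (Subtype.ext h'')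
      obtain ⟨j, hj⟩ := Function.ne_iff.mp h'
      exact ⟨j, fun _ h0 ↦ hj (congrArg Subtype.val (sub_eq_zero.mp h0)).symm⟩
  choose j hj using hne
  let q : MvPolynomial (Fin 2) O := ∏ z ∈ Finset.univ.erase z₀, (X (j z) - C (ζ z (j z)))
  have hq0 : eval (ζ z₀) q ≠ 0 := by
    rw [map_prod, Finset.prod_ne_zero_iff]
    intro z hz
    rw [map_sub, eval_X, eval_C]
    exact hj z (Finset.ne_of_mem_erase hz)
  have hq (z : Z) (hz : z ≠ z₀) : eval (ζ z) q = 0 := by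
    rw [map_prod]
    refine Finset.prod_eq_zero (Finset.mem_erase.mpr ⟨hz, Finset.mem_univ z⟩) ?_
    rw [map_sub, eval_X, eval_C, sub_self]
  have hsingle : Pi.basisFun K Z z₀ =
      ((eval (ζ z₀) q : O) : K)⁻¹ • fun z : Z ↦ ((eval (ζ z) q : O) : K) := by
    have hq0' : ((eval (ζ z₀) q : O) : K) ≠ 0 := fun h ↦ hq0 (Subtype.ext h)
    funext z
    rw [Pi.basisFun_apply, Pi.smul_apply, smul_eq_mul]
    by_cases hz : z = z₀
    · rw [hz, Pi.single_eq_same, inv_mul_cancel₀ hq0']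
    · rw [Pi.single_eq_of_ne hz, hq z hz]
      exact (mul_zero _).symm
  rw [hsingle]
  exact Submodule.smul_mem _ _ (hmem q)

end SurjectiveOnPoints

/-! ### The length of the local ring of the special fibre -/

section Length

variable {L : Type u} [Field L]

theorem height_originIdeal_le : (originIdeal L).height ≤ 2 := by
  have h := Ideal.height_le_ringKrullDim_of_isPrime (I := originIdeal L)
  rw [MvPolynomial.ringKrullDim_of_isNoetherianRing, ringKrullDim_eq_zero_of_field, zero_add,
    Nat.card_eq_fintype_card, Fintype.card_fin] at h
  exact WithBot.coe_le_coe.mp h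

/-- The origin is an isolated point of the curves' intersection: a prime below the maximal ideal of
the origin that contains `p₁` and `p₂` is not principal, so its height is at least `2`. -/
theorem eq_originIdeal_of_isPrime {p₁ p₂ : MvPolynomial (Fin 2) L}
    (hcomp : ∀ d, d ∣ p₁ → d ∣ p₂ → eval 0 d ≠ 0) {Q : Ideal (MvPolynomial (Fin 2) L)} [Q.IsPrime]
    (h₁ : p₁ ∈ Q) (h₂ : p₂ ∈ Q) (hQ : Q ≤ originIdeal L) : Q = originIdeal L := by
  have hQ0 : Q ≠ ⊥ := by
    rintro rfl
    rw [Ideal.mem_bot] at h₁ h₂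
    subst h₁ h₂
    exact hcomp 0 dvd_rfl dvd_rfl (map_zero _)
  obtain ⟨g, hg, hgp⟩ := Ideal.IsPrime.exists_mem_prime_of_ne_bot ‹_› hQ0
  have : (Ideal.span {g}).IsPrime := (Ideal.span_singleton_prime hgp.ne_zero).mpr hgp
  have hlt₀ : ⊥ < Ideal.span {g} := by
    rw [bot_lt_iff_ne_bot, Ne, Ideal.span_singleton_eq_bot]
    exact hgp.ne_zero
  have hlt₁ : Ideal.span {g} < Q := by
    refine lt_of_le_of_ne ((Ideal.span_singleton_le_iff_mem Q).mpr hg) ?_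
    rintro rfl
    rw [Ideal.mem_span_singleton] at h₁ h₂
    exact hcomp g h₁ h₂ (hQ hg)
  by_contra hne
  have hlt₂ : Q < originIdeal L := lt_of_le_of_ne hQ hne
  have h0 := Ideal.height_strict_mono_of_isPrime_of_isPrime hlt₀
  have h1 := Ideal.height_strict_mono_of_isPrime_of_isPrime hlt₁
  have h2 := Ideal.height_strict_mono_of_isPrime_of_isPrime hlt₂
  have h3 := Order.add_one_le_of_lt (lt_of_le_of_lt zero_le h0)
  have h4 := Order.add_one_le_of_lt (lt_of_le_of_lt h3 h1)
  have h5 := lt_of_le_of_lt h4 (h2.trans_le height_originIdeal_le)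
  norm_num at h5

variable (p₁ p₂ : MvPolynomial (Fin 2) L)

/-- The ideal of `p₁` and `p₂` in the local ring at the origin. -/
noncomputable abbrev localIdeal : Ideal (Localization.AtPrime (originIdeal L)) :=
  Ideal.span {algebraMap (MvPolynomial (Fin 2) L) (Localization.AtPrime (originIdeal L)) p₁,
    algebraMap (MvPolynomial (Fin 2) L) (Localization.AtPrime (originIdeal L)) p₂}

theorem algebraMap_mem_localIdeal {f : MvPolynomial (Fin 2) L} :
    algebraMap _ _ f ∈ localIdeal p₁ p₂ ↔
      ∃ s : MvPolynomial (Fin 2) L, eval 0 s ≠ 0 ∧ s * f ∈ Ideal.span {p₁, p₂} := by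
  have h : localIdeal p₁ p₂ = (Ideal.span {p₁, p₂}).map
      (algebraMap (MvPolynomial (Fin 2) L) (Localization.AtPrime (originIdeal L))) := by
    rw [Ideal.map_span, Set.image_pair]
  rw [h, IsLocalization.algebraMap_mem_map_algebraMap_iff (originIdeal L).primeCompl]
  rfl

variable {p₁ p₂}

theorem isArtinianRing_quotient_localIdeal
    (hcomp : ∀ d, d ∣ p₁ → d ∣ p₂ → eval 0 d ≠ 0) :
    IsArtinianRing (Localization.AtPrime (originIdeal L) ⧸ localIdeal p₁ p₂) := by
  refine (isArtinianRing_iff_isNoetherianRing_krullDimLE_zero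
    (R := Localization.AtPrime (originIdeal L) ⧸ localIdeal p₁ p₂)).mpr
    ⟨inferInstance, Ring.krullDimLE_zero_iff.mpr fun q hq ↦ ?_⟩
  let q' := q.comap (Ideal.Quotient.mk (localIdeal p₁ p₂))
  have hI : localIdeal p₁ p₂ ≤ q' := by
    intro x hx
    rw [Ideal.mem_comap, Ideal.Quotient.eq_zero_iff_mem.mpr hx]
    exact q.zero_mem
  have hq' : q'.IsPrime := Ideal.comap_isPrime _ _
  let Q := q'.comap (algebraMap (MvPolynomial (Fin 2) L) (Localization.AtPrime (originIdeal L)))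
  have hQp : Q.IsPrime := Ideal.comap_isPrime _ _
  have hle : Q ≤ originIdeal L := by
    have h := IsLocalRing.le_maximalIdeal hq'.ne_top
    exact (Ideal.comap_mono h).trans (Localization.AtPrime.under_maximalIdeal).le
  have hQ : Q = originIdeal L := eq_originIdeal_of_isPrime hcomp
    (hI (Ideal.subset_span (Set.mem_insert _ _)))
    (hI (Ideal.subset_span (Set.mem_insert_of_mem _ rfl))) hle
  have hmax : q' = IsLocalRing.maximalIdeal _ :=
    Localization.AtPrime.eq_maximalIdeal_iff_under_eq.mp hQ
  have : q'.IsMaximal := hmax ▸ inferInstance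
  have hmap := Ideal.map_comap_of_surjective _ Ideal.Quotient.mk_surjective q
  rw [← hmap]
  refine (Ideal.map_eq_top_or_isMaximal_of_surjective _ Ideal.Quotient.mk_surjective
    this).resolve_left ?_
  rw [hmap]
  exact hq.ne_top

theorem intersectionMultiplicity_ne_top (hcomp : ∀ d, d ∣ p₁ → d ∣ p₂ → eval 0 d ≠ 0) :
    intersectionMultiplicity p₁ p₂ ≠ ⊤ := by
  have h := isArtinianRing_quotient_localIdeal hcomp
  rw [intersectionMultiplicity, Module.length_eq_of_surjective
    (R := Localization.AtPrime (originIdeal L) ⧸ localIdeal p₁ p₂) Ideal.Quotient.mk_surjective,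
    Module.length_ne_top_iff, isFiniteLength_iff_isNoetherian_isArtinian]
  exact ⟨inferInstance, h⟩

/-- The residue field of the local ring at the origin is `L`, so the length over the local
ring is the dimension over `L`. -/
theorem length_eq_length_field (M : Type*) [AddCommGroup M]
    [Module (Localization.AtPrime (originIdeal L)) M] [Module L M]
    [IsScalarTower L (Localization.AtPrime (originIdeal L)) M] :
    Module.length (Localization.AtPrime (originIdeal L)) M = Module.length L M := by
  have h := IsLocalRing.length_restrictScalars L (Localization.AtPrime (originIdeal L)) M
  have hsurj : Function.Surjective (algebraMap (IsLocalRing.ResidueField L)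
      (IsLocalRing.ResidueField (Localization.AtPrime (originIdeal L)))) := by
    intro x
    obtain ⟨x, rfl⟩ := IsLocalRing.residue_surjective x
    obtain ⟨f, s, rfl⟩ := IsLocalization.exists_mk'_eq (originIdeal L).primeCompl x
    have hs : eval 0 (s : MvPolynomial (Fin 2) L) ≠ 0 := s.2
    let c : L := eval 0 f / eval 0 (s : MvPolynomial (Fin 2) L)
    refine ⟨IsLocalRing.residue L c, ?_⟩
    rw [IsLocalRing.ResidueField.algebraMap_residue, eq_comm, ← sub_eq_zero, ← map_sub,
      IsLocalRing.residue_eq_zero_iff]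
    have hmem : algebraMap _ (Localization.AtPrime (originIdeal L))
        (f - C c * (s : MvPolynomial (Fin 2) L)) ∈ IsLocalRing.maximalIdeal _ := by
      rw [IsLocalization.AtPrime.to_map_mem_maximal_iff _ (originIdeal L), RingHom.mem_ker,
        map_sub, map_mul, eval_C, div_mul_cancel₀ _ hs, sub_self]
    have hs' : algebraMap _ (Localization.AtPrime (originIdeal L))
        (s : MvPolynomial (Fin 2) L) ∉ IsLocalRing.maximalIdeal _ := by
      rw [IsLocalization.AtPrime.to_map_mem_maximal_iff _ (originIdeal L)]
      exact s.2
    rw [map_sub, map_mul, ← IsLocalization.mk'_spec (Localization.AtPrime (originIdeal L)) f s,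
      ← sub_mul] at hmem
    exact (Ideal.IsPrime.mem_or_mem inferInstance hmem).resolve_right hs'
  have h1 : Module.length (IsLocalRing.ResidueField L)
      (IsLocalRing.ResidueField (Localization.AtPrime (originIdeal L))) = 1 := by
    rw [Module.length_eq_of_surjective hsurj, Module.length_eq_one]
  rw [h, h1, mul_one]

/-- The image of an algebra in a finite-dimensional algebra is stable under the inverses which
exist in the latter. -/
theorem exists_map_mul_eq_one {A D : Type*} [CommRing A] [CommRing D] [Algebra L A] [Algebra L D]
    [Module.Finite L D] (φ : A →ₐ[L] D) {s : A} (hs : IsUnit (φ s)) : ∃ s', φ s' * φ s = 1 := by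
  -- Multiplication by `φ s` is injective on the finite-dimensional range, hence surjective.
  let V := LinearMap.range φ.toLinearMap
  let T : V →ₗ[L] V := (LinearMap.mulRight L (φ s)).restrict (by
    rintro _ ⟨x, rfl⟩
    exact ⟨x * s, map_mul φ x s⟩)
  have hT : Function.Injective T := fun x y hxy ↦
    Subtype.ext (hs.mul_right_cancel (congrArg Subtype.val hxy))
  obtain ⟨⟨_, s', rfl⟩, h⟩ := (LinearMap.injective_iff_surjective.mp hT) ⟨1, 1, map_one φ⟩
  exact ⟨s', congrArg Subtype.val h⟩

theorem exists_basis_localRing (hcomp : ∀ d, d ∣ p₁ → d ∣ p₂ → eval 0 d ≠ 0) :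
    ∃ (n : ℕ) (e : Fin n → MvPolynomial (Fin 2) L), intersectionMultiplicity p₁ p₂ = n ∧
      (∀ c : Fin n → L, (∃ s : MvPolynomial (Fin 2) L, eval 0 s ≠ 0 ∧
        s * ∑ i, C (c i) * e i ∈ Ideal.span {p₁, p₂}) → c = 0) ∧
      ∀ f, ∃ c : Fin n → L, ∃ s : MvPolynomial (Fin 2) L, eval 0 s ≠ 0 ∧
        s * (f - ∑ i, C (c i) * e i) ∈ Ideal.span {p₁, p₂} := by
  have hD : Module.length L (Localization.AtPrime (originIdeal L) ⧸ localIdeal p₁ p₂) =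
      intersectionMultiplicity p₁ p₂ := (length_eq_length_field _).symm
  have hfl : IsFiniteLength L (Localization.AtPrime (originIdeal L) ⧸ localIdeal p₁ p₂) := by
    rw [← Module.length_ne_top_iff, hD]
    exact intersectionMultiplicity_ne_top hcomp
  have := (isFiniteLength_iff_isNoetherian_isArtinian.mp hfl).1
  have hfin : Module.Finite L (Localization.AtPrime (originIdeal L) ⧸ localIdeal p₁ p₂) :=
    inferInstance
  let φ : MvPolynomial (Fin 2) L →ₐ[L] Localization.AtPrime (originIdeal L) ⧸ localIdeal p₁ p₂ :=
    (Ideal.Quotient.mkₐ L (localIdeal p₁ p₂)).comp (IsScalarTower.toAlgHom L _ _)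
  have hφ (f) : φ f = 0 ↔
      ∃ s : MvPolynomial (Fin 2) L, eval 0 s ≠ 0 ∧ s * f ∈ Ideal.span {p₁, p₂} := by
    rw [← algebraMap_mem_localIdeal]
    exact Ideal.Quotient.eq_zero_iff_mem
  have hsurj : Function.Surjective φ := by
    intro x
    obtain ⟨x, rfl⟩ := Ideal.Quotient.mk_surjective x
    obtain ⟨f, s, rfl⟩ := IsLocalization.exists_mk'_eq (originIdeal L).primeCompl x
    have hs : IsUnit (φ s) := (IsLocalization.map_units (Localization.AtPrime (originIdeal L))
      s).map (Ideal.Quotient.mk (localIdeal p₁ p₂))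
    obtain ⟨s', hs'⟩ := exists_map_mul_eq_one
      (D := Localization.AtPrime (originIdeal L) ⧸ localIdeal p₁ p₂) φ hs
    refine ⟨f * s', hs.mul_right_cancel ?_⟩
    rw [map_mul, mul_assoc, hs', mul_one]
    change Ideal.Quotient.mk _ _ = Ideal.Quotient.mk _ _ * Ideal.Quotient.mk _ _
    rw [← map_mul, AlgHom.coe_toRingHom, IsScalarTower.coe_toAlgHom', IsLocalization.mk'_spec]
  let b := Module.finBasis L (Localization.AtPrime (originIdeal L) ⧸ localIdeal p₁ p₂)
  choose e he using fun i ↦ hsurj (b i)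
  have hsum (c : Fin (Module.finrank L
      (Localization.AtPrime (originIdeal L) ⧸ localIdeal p₁ p₂)) → L) :
      φ (∑ i, C (c i) * e i) = ∑ i, c i • b i := by
    rw [map_sum]
    refine Finset.sum_congr rfl fun i _ ↦ ?_
    rw [← smul_eq_C_mul, map_smul, he]
  refine ⟨_, e, ?_, ?_, ?_⟩
  · rw [← hD, Module.length_eq_finrank]
  · intro c hc
    rw [← hφ, hsum] at hc
    exact funext (Fintype.linearIndependent_iff.mp b.linearIndependent c hc)
  · intro f
    refine ⟨b.repr (φ f), ?_⟩
    rw [← hφ, map_sub, hsum, b.sum_repr, sub_self]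

end Length

/-! ### The multiplicity theorem -/

theorem mem_fibre_coverIdeal {L : Type u} [Field L] {p₁ p₂ : MvPolynomial (Fin 2) L}
    {a w : Fin 2 → Kω L} :
    w ∈ fibre (coverIdeal p₁ p₂) a ↔ ∀ i, aeval w (![p₁, p₂] i) = a i := by
  have h1 (p : MvPolynomial (Fin 2) L) (i : Fin 2) :
      aeval (Sum.elim a w) (rename Sum.inr p - X (Sum.inl i)) = 0 ↔ aeval w p = a i := by
    rw [map_sub, aeval_rename, aeval_X, Sum.elim_comp_inr, Sum.elim_inl, sub_eq_zero]
  have h2 : w ∈ fibre (coverIdeal p₁ p₂) a ↔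
      coverIdeal p₁ p₂ ≤ RingHom.ker (aeval (R := L) (Sum.elim a w)) := Iff.rfl
  rw [h2, coverIdeal, Ideal.span_le, Set.pair_subset_iff, SetLike.mem_coe, SetLike.mem_coe,
    RingHom.mem_ker, RingHom.mem_ker, h1, h1, Fin.forall_fin_two]
  rfl

end ZariskiStructure

theorem theorem6p10 {L : Type u} [Field L] [IsAlgClosed L] [CharZero L]
    (p₁ p₂ : MvPolynomial (Fin 2) L)
    (h₁ : MvPolynomial.eval (0 : Fin 2 → L) p₁ = 0)
    (h₂ : MvPolynomial.eval (0 : Fin 2 → L) p₂ = 0)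
    (hcomp : ∀ d : MvPolynomial (Fin 2) L, d ∣ p₁ → d ∣ p₂ →
      MvPolynomial.eval (0 : Fin 2 → L) d ≠ 0) :
    ∃ n : ℕ, ZariskiStructure.intersectionMultiplicity p₁ p₂ = n ∧
      ZariskiStructure.HasZariskiMultiplicity (ZariskiStructure.coverIdeal p₁ p₂)
        (0 : Fin 2 → L) (0 : Fin 2 → L) n := by
  open ZariskiStructure in
  obtain ⟨n, e, hn, hind, hspan⟩ := exists_basis_localRing hcomp
  refine ⟨n, hn, exists_generic_mem_infNhd L, fun a ha hgen ↦ ?_⟩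
  obtain ⟨O, _, _, ρ, hρ⟩ := Kω.exists_place L
  have hinf (w : Fin 2 → Kω L) : w ∈ infNhd (0 : Fin 2 → L) ↔ ∀ j, w j ∈ placeKernel ρ := by
    rw [mem_infNhd_zero]
    exact forall_congr' fun j ↦ hρ (w j)
  have halg : AlgebraicIndependent L a := algebraicIndependent_iff.mpr hgen
  have hK : KoszulExactAtOrigin (![p₁, p₂] 0) (![p₁, p₂] 1) :=
    koszulExactAtOrigin_of_no_common_factor h₂ hcomp
  have ha0 := (hinf a).mp ha
  let Z := fibre (coverIdeal p₁ p₂) a ∩ infNhd 0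
  have hZ (w) : w ∈ Z ↔ (∀ i, aeval w (![p₁, p₂] i) = a i) ∧ ∀ j, w j ∈ placeKernel ρ :=
    and_congr mem_fibre_coverIdeal (hinf w)
  have hfin : Z.Finite := (finite_fibre_of_generic halg).subset fun w hw ↦ ((hZ w).mp hw).1
  have : Finite Z := hfin
  have := Fintype.ofFinite Z
  have hinj := linearCombination_injective ρ ![p₁, p₂] hK halg ha0 (Z := Z)
    (fun w hw hw0 ↦ (hZ w).mpr ⟨hw, hw0⟩) e hind
  have hsurj := linearCombination_surjective ρ ![p₁, p₂] ha0 (Z := Z)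
    (fun w hw ↦ (hZ w).mp hw) e hspan
  have hcard := (LinearEquiv.ofBijective _ ⟨hinj, hsurj⟩).finrank_eq
  rw [Module.finrank_fintype_fun_eq_card, Module.finrank_fintype_fun_eq_card, Fintype.card_fin]
    at hcard
  change Z.encard = n
  rw [Set.encard_eq_coe_toFinset_card, Set.toFinset_card, hcard]
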